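/- **Localized dispersive estimate and its interpolated form.** Let $d\in\{1,2\}$ and let $m_1(\xi)=\xi\sqrt{\tanh(\xi)/\xi}$ for $\xi\in\mathbb R$, $m_2(\xi)=|\xi|\sqrt{\tanh(|\xi|)/|\xi|}$ for $\xi\in\mathbb R^2$ (both taken to be $0$ at $\xi=0$). Fix an even real-valued $\chi\in C_0^\infty((-2,2))$ with $\chi(s)=1$ for $|s|\le 1$, and put $\beta(s)=\chi(s)-\chi(2s)$. With the Fourier transform $\hat f(\xi)=\int_{\mathbb R^d}e^{-ix\cdot\xi}f(x)\,dx$, extended to tempered distributions, define for $\lambda=2^k>1$ ($k\in\mathbb Z$) and $\tau\in\mathbb R$ the localized free wave $S_{m_d}(\tau)P_\lambda f=e^{-i\tau m_d(D)}P_\lambda f$ by $$\widehat{S_{m_d}(\tau)P_\lambda f}(\xi)=e^{-i\tau m_d(\xi)}\,\beta(|\xi|/\lambda)\,\hat f(\xi)$$ (the symbol is smooth and compactly supported). Then there is a constant $C>0$, depending only on $d$ and $\chi$, such that for every dyadic $\lambda=2^k>1$, every real $t\ne0$ and both choices of the sign $\pm$: 1. for every $f\in L^1(\mathbb R^d)$,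 $S_{m_d}(\pm t)P_\lambda f$ belongs to $L^\infty(\mathbb R^d)$ and $$\|S_{m_d}(\pm t)P_\lambda f\|_{L^\infty(\mathbb R^d)}\le C\,\lambda^{3d/4}|t|^{-d/2}\,\|f\|_{L^1(\mathbb R^d)};$$ 2. for every $2\le r\le\infty$ with $\frac1r+\frac1{r'}=1$ and every $f\in L^{r'}(\mathbb R^d)$, $S_{m_d}(\pm t)P_\lambda f$ belongs to $L^r(\mathbb R^d)$ and $$\|S_{m_d}(\pm t)P_\lambda f\|_{L^r(\mathbb R^d)}\le C\left(\lambda^{3d/4}|t|^{-d/2}\right)^{1-2/r}\|f\|_{L^{r'}(\mathbb R^d)}.$$ Functions are complex-valued. -/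

import Mathlib

open MeasureTheory FourierTransform
open scoped ENNReal SchwartzMap ContDiff

/-- The dispersion symbol `m_d`, in the angular frequency variable `ξ`:
`m₁(ξ) = ξ √(tanh ξ / ξ)` on `ℝ¹`, which is odd, and `m_d(ξ) = |ξ| √(tanh |ξ| / |ξ|)` otherwise
(only `d = 2` is of interest).  At `ξ = 0` both products are `0`. -/
noncomputable def dispersionSymbol : (d : ℕ) → EuclideanSpace ℝ (Fin d) → ℝ
  | 1, ξ => ξ 0 * √(Real.tanh (ξ 0) / ξ 0)
  | _, ξ => ‖ξ‖ * √(Real.tanh ‖ξ‖ / ‖ξ‖)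

/-- A cut-off: an even `χ ∈ C_0^∞((-2,2))` with `χ = 1` on `[-1,1]`. -/
structure IsCutoff (χ : ℝ → ℝ) : Prop where
  smooth : ContDiff ℝ ∞ χ
  tsupport_subset : tsupport χ ⊆ Set.Ioo (-2) 2
  even : ∀ s, χ (-s) = χ s
  eq_one : ∀ s, |s| ≤ 1 → χ s = 1

/-- The symbol `β_λ(|ξ|)` of the Littlewood-Paley projection `P_λ`, for `λ > 1`, where
`β(s) = χ(s) - χ(2s)` and `β_λ(s) = β(s/λ)`. -/
noncomputable def projectionSymbol (χ : ℝ → ℝ) {d : ℕ} (lam : ℝ)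
    (ξ : EuclideanSpace ℝ (Fin d)) : ℝ :=
  χ (‖ξ‖ / lam) - χ (2 * (‖ξ‖ / lam))

/-- The symbol `e^{-iτ m_d(ξ)}` of the propagator `S_{m_d}(τ) = e^{-iτ m_d(D)}`. -/
noncomputable def propagatorSymbol (d : ℕ) (τ : ℝ) (ξ : EuclideanSpace ℝ (Fin d)) : ℂ :=
  Complex.exp (-(Complex.I * τ * dispersionSymbol d ξ))

/-- The Fourier multiplier `a(D)`, `D = -i∇`, on tempered distributions.  The symbol `a` is a
function of the angular frequency, i.e. it belongs to the Fourier transform with kernel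
`e^{-i x·ξ}`, whereas Mathlib's transform has kernel `e^{-2π i x·ζ}`; thus `ξ = 2πζ`. -/
noncomputable def angularMultiplier {d : ℕ} (a : EuclideanSpace ℝ (Fin d) → ℂ) :
    𝓢'(EuclideanSpace ℝ (Fin d), ℂ) →L[ℂ] 𝓢'(EuclideanSpace ℝ (Fin d), ℂ) :=
  TemperedDistribution.fourierMultiplierCLM ℂ fun ζ => a ((2 * Real.pi) • ζ)

/-- The localized free wave `f ↦ S_{m_d}(τ) P_λ f = e^{-iτ m_d(D)} P_λ f`: the Fourier multiplier
with symbol `e^{-iτ m_d(ξ)} β_λ(|ξ|)`. -/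
noncomputable def localizedWave (χ : ℝ → ℝ) (d : ℕ) (lam τ : ℝ) :
    𝓢'(EuclideanSpace ℝ (Fin d), ℂ) →L[ℂ] 𝓢'(EuclideanSpace ℝ (Fin d), ℂ) :=
  angularMultiplier fun ξ => propagatorSymbol d τ ξ * (projectionSymbol χ lam ξ : ℂ)

/-- The symbol of the localized free wave is smooth with compact support, so that
`TemperedDistribution.fourierMultiplierCLM` does not take its default value in
`localizedWave`. -/
theorem hasTemperateGrowth_localizedWave_symbol {χ : ℝ → ℝ} (hχ : IsCutoff χ) (d : ℕ)
    {lam : ℝ} (hlam : 0 < lam) (τ : ℝ) :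
    (fun ζ : EuclideanSpace ℝ (Fin d) =>
      propagatorSymbol d τ ((2 * Real.pi) • ζ) *
        (projectionSymbol χ lam ((2 * Real.pi) • ζ) : ℂ)).HasTemperateGrowth := by
  -- the scalar dispersion relation is smooth away from zero
  have hpos : ∀ x : ℝ, x ≠ 0 → 0 < Real.tanh x / x := by
    intro x hx
    rw [Real.tanh_eq_sinh_div_cosh, div_right_comm]
    refine div_pos ?_ (Real.cosh_pos x)
    rcases lt_or_gt_of_ne hx with h | h
    · exact div_pos_of_neg_of_neg (Real.sinh_neg_iff.2 h) h
    · exact div_pos (Real.sinh_pos_iff.2 h) h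
  have hm : ∀ x : ℝ, x ≠ 0 → ContDiffAt ℝ ∞ (fun y : ℝ => y * √(Real.tanh y / y)) x := by
    intro x hx
    have h1 : ContDiffAt ℝ ∞ Real.tanh x := by
      have : Real.tanh = fun y => Real.sinh y / Real.cosh y := by
        funext y; exact Real.tanh_eq_sinh_div_cosh y
      rw [this]
      exact Real.contDiff_sinh.contDiffAt.div Real.contDiff_cosh.contDiffAt (Real.cosh_pos x).ne'
    exact contDiffAt_id.mul ((h1.div contDiffAt_id hx).sqrt (hpos x hx).ne')
  have hn : ∀ ξ : EuclideanSpace ℝ (Fin d), ξ ≠ 0 →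
      ContDiffAt ℝ ∞ (fun η : EuclideanSpace ℝ (Fin d) => ‖η‖ * √(Real.tanh ‖η‖ / ‖η‖)) ξ :=
    fun ξ hξ => (hm ‖ξ‖ (norm_ne_zero_iff.2 hξ)).comp ξ (contDiffAt_norm ℝ hξ)
  have hd : ∀ ξ : EuclideanSpace ℝ (Fin d), ξ ≠ 0 → ContDiffAt ℝ ∞ (dispersionSymbol d) ξ := by
    intro ξ hξ
    match d, ξ, hξ, hn with
    | 0, ξ, hξ, hn => exact hn ξ hξ
    | 1, ξ, hξ, _ =>
      have h0 : ξ 0 ≠ 0 := by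
        intro h
        apply hξ
        ext i
        rw [Subsingleton.elim i 0]
        exact h
      have hc : ContDiff ℝ ∞ (fun η : EuclideanSpace ℝ (Fin 1) => η 0) := by fun_prop
      exact ContDiffAt.comp (g := fun y : ℝ => y * √(Real.tanh y / y)) ξ (hm (ξ 0) h0)
        hc.contDiffAt
    | (n + 2), ξ, hξ, hn => exact hn ξ hξ
  -- smoothness of the full symbol
  have hsm : ContDiff ℝ ∞ (fun ξ : EuclideanSpace ℝ (Fin d) =>
      propagatorSymbol d τ ξ * (projectionSymbol χ lam ξ : ℂ)) := by
    rw [contDiff_iff_contDiffAt]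
    intro ξ
    by_cases hξ : ξ = 0
    · have hev : (fun ξ : EuclideanSpace ℝ (Fin d) =>
          propagatorSymbol d τ ξ * (projectionSymbol χ lam ξ : ℂ)) =ᶠ[nhds ξ] fun _ => 0 := by
        have hb : Metric.ball (0 : EuclideanSpace ℝ (Fin d)) (lam / 2) ∈ nhds ξ := by
          rw [hξ]; exact Metric.ball_mem_nhds _ (by positivity)
        filter_upwards [hb] with η hη
        rw [mem_ball_zero_iff] at hη
        have h1 : 0 ≤ ‖η‖ / lam := by positivity
        have h2 : ‖η‖ / lam ≤ 1 / 2 := by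
          rw [div_le_iff₀ hlam]; linarith
        simp only [projectionSymbol]
        rw [hχ.eq_one _ (by rw [abs_of_nonneg h1]; linarith),
          hχ.eq_one _ (by rw [abs_of_nonneg (by positivity)]; linarith)]
        simp
      exact contDiffAt_const.congr_of_eventuallyEq hev
    · have h1 := Complex.ofRealCLM.contDiff.contDiffAt.comp ξ (hd ξ hξ)
      have h2 : ContDiffAt ℝ ∞ (projectionSymbol (d := d) χ lam) ξ := by
        have hs : ContDiffAt ℝ ∞ (fun η : EuclideanSpace ℝ (Fin d) => ‖η‖ / lam) ξ :=
          (contDiffAt_norm ℝ hξ).div_const lam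
        exact (hχ.smooth.contDiffAt.comp ξ hs).sub
          (hχ.smooth.contDiffAt.comp ξ (contDiffAt_const.mul hs))
      have h3 := Complex.ofRealCLM.contDiff.contDiffAt.comp ξ h2
      exact (contDiffAt_const.mul h1).neg.cexp.mul h3
  -- compact support
  have hcpt : HasCompactSupport (fun ξ : EuclideanSpace ℝ (Fin d) =>
      propagatorSymbol d τ ξ * (projectionSymbol χ lam ξ : ℂ)) := by
    refine HasCompactSupport.intro (isCompact_closedBall 0 (2 * lam)) fun ξ hξ => ?_
    have hbig : 2 * lam < ‖ξ‖ := by simpa using hξ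
    have hz : ∀ s : ℝ, 2 ≤ s → χ s = 0 := by
      intro s hs
      by_contra h
      have := (hχ.tsupport_subset (subset_tsupport χ h)).2
      linarith
    have h2 : 2 ≤ ‖ξ‖ / lam := by
      rw [le_div_iff₀ hlam]; linarith
    simp [projectionSymbol, hz _ h2, hz (2 * (‖ξ‖ / lam)) (by linarith)]
  have hg := hcpt.hasTemperateGrowth hsm
  have hl : (fun ζ : EuclideanSpace ℝ (Fin d) => (2 * Real.pi) • ζ).HasTemperateGrowth := by
    fun_prop
  exact hg.comp hl

/-!
The localized wave is convolution with the kernel `K = 𝓕⁻¹ (e^{-iτ m_d} β_λ)`, so the estimate from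
`L¹` to `L^∞` is the pointwise bound `|K(x)| ≤ C (λ^{3/4} |τ|^{-1/2})^d`, and the estimates from
`L^{r'}` to `L^r` follow by interpolation with Plancherel's theorem on `L²`.

**The kernel.** The radial profile `m(r) = √(r tanh r)` of the dispersion relation satisfies
`m'(r) ≥ c r^{-1/2}` and `-m''(r) ≥ c r^{-3/2}` for `r ≥ 1`. On the shell `λ/2 ≤ r ≤ 2λ`, where
`r ≥ 1` because a dyadic `λ > 1` is at least `2`, the phase `y r - τ m(r)` therefore has second
derivative at least `c |τ| λ^{-3/2}` in absolute value, and van der Corput's second derivative test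
gives the rate `λ^{3/4} |τ|^{-1/2}` in dimension one, uniformly in `y`. In dimension two, polar
coordinates turn the kernel into `∫ e^{-iτ m(r)} β(r/λ) r J₀(r|x|) dr` up to a constant. If `|x|`
is small against `|τ| λ^{-1/2}`, the phase has no stationary point for any angle and the first
derivative test suffices. Otherwise, if `λ|x| ≥ 2`, then `J₀` is written as
`e^{iz} a₊(z) + e^{-iz} a₋(z)` with `|a_±| ≲ z^{-1/2}` and `|a_±'| ≲ z^{-3/2}`, and the gain
`(λ|x|)^{-1/2}` combines with the second derivative test. In the remaining case `|τ| ≲ λ^{-1/2}`,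
and the trivial bound `λ²` suffices. The amplitudes come from variation of constants: by Bessel's
equation the energy of `√z J₀(z)` is bounded for `z ≥ 1` (`exists_norm_besselAmp_le`). The outcome
is `exists_norm_waveKernel_le`.

**The multiplier.** On Schwartz functions the `L¹`-`L^∞` bound is the one on the kernel, and it
passes to all of `L¹` by density (`mapsLpBound_of_dense`). The `L²` bound is Plancherel's theorem,
as the symbol is bounded.

**Interpolation.** The Riesz-Thorin theorem is needed only for `1/r + 1/r' = 1` between these two
endpoints. On step functions over finitely many sets it is a statement about bilinear forms on
finite weighted `ℓ^p` spaces, which follows from Hadamard's three lines theorem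
(`norm_le_weightedNorm_of_endpoints`). Bounds on pairings with simple functions are bounds on the
`L^r` norm by duality (`norm_le_of_forall_simpleFunc`), and simple functions are dense in `L^{r'}`.
-/

/-! ### Van der Corput's lemma -/

open intervalIntegral in
/-- First derivative test.  The phase has monotone derivative, so that integrating by parts against
`1 / φ'`, whose total variation is at most `1 / μ`, gives a bound independent of the interval. -/
theorem norm_integral_cexp_le_of_deriv {φ φ' φ'' : ℝ → ℝ} {a b μ : ℝ} (hab : a ≤ b) (hμ : 0 < μ)
    (h1 : ∀ x ∈ Set.Icc a b, HasDerivAt φ (φ' x) x)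
    (h2 : ∀ x ∈ Set.Icc a b, HasDerivAt φ' (φ'' x) x)
    (h3 : ContinuousOn φ'' (Set.Icc a b)) (h4 : ∀ x ∈ Set.Icc a b, 0 ≤ φ'' x)
    (h5 : (∀ x ∈ Set.Icc a b, μ ≤ φ' x) ∨ (∀ x ∈ Set.Icc a b, φ' x ≤ -μ)) :
    ‖∫ x in a..b, Complex.exp (Complex.I * φ x)‖ ≤ 3 / μ := by
  have hne : ∀ x ∈ Set.Icc a b, φ' x ≠ 0 := by
    intro x hx
    rcases h5 with h | h
    · exact (hμ.trans_le (h x hx)).ne'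
    · have := h x hx; intro h0; linarith
  have hinv : ∀ x ∈ Set.Icc a b, |(φ' x)⁻¹| ≤ 1 / μ := by
    intro x hx
    rw [abs_inv, inv_eq_one_div]
    apply one_div_le_one_div_of_le hμ
    rcases h5 with h | h
    · exact (h x hx).trans (le_abs_self _)
    · have := h x hx; have := neg_le_abs (φ' x); linarith
  have hcφ' : ContinuousOn φ' (Set.Icc a b) := fun x hx => (h2 x hx).continuousAt.continuousWithinAt
  have hcφ : ContinuousOn φ (Set.Icc a b) := fun x hx => (h1 x hx).continuousAt.continuousWithinAt
  have hd1 : ∀ x ∈ Set.Icc a b, HasDerivAt (fun y => (φ' y)⁻¹) (-φ'' x / φ' x ^ 2) x :=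
    fun x hx => (h2 x hx).inv (hne x hx)
  have hcd : ContinuousOn (fun x => -φ'' x / φ' x ^ 2) (Set.Icc a b) :=
    h3.neg.div (hcφ'.pow 2) fun x hx => pow_ne_zero 2 (hne x hx)
  have hdu : ∀ x ∈ Set.uIcc a b, HasDerivAt (fun y => -Complex.I * (((φ' y)⁻¹ : ℝ) : ℂ))
      (-Complex.I * ((-φ'' x / φ' x ^ 2 : ℝ) : ℂ)) x := by
    intro x hx
    rw [Set.uIcc_of_le hab] at hx
    exact ((hd1 x hx).ofReal_comp).const_mul _
  have hdv : ∀ x ∈ Set.uIcc a b, HasDerivAt (fun y => Complex.exp (Complex.I * φ y))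
      (Complex.exp (Complex.I * φ x) * (Complex.I * φ' x)) x := by
    intro x hx
    rw [Set.uIcc_of_le hab] at hx
    exact (((h1 x hx).ofReal_comp).const_mul _).cexp
  have hcd' : ContinuousOn (fun x => ((-φ'' x / φ' x ^ 2 : ℝ) : ℂ)) (Set.Icc a b) :=
    Complex.continuous_ofReal.comp_continuousOn hcd
  have hce : ContinuousOn (fun x => Complex.exp (Complex.I * φ x)) (Set.Icc a b) :=
    (continuousOn_const.mul (Complex.continuous_ofReal.comp_continuousOn hcφ)).cexp
  have hibp := integral_mul_deriv_eq_deriv_mul hdu hdv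
    ((continuousOn_const.mul hcd').intervalIntegrable_of_Icc hab)
    ((hce.mul (continuousOn_const.mul
      (Complex.continuous_ofReal.comp_continuousOn hcφ'))).intervalIntegrable_of_Icc hab)
  have hL : ∫ x in a..b, -Complex.I * (((φ' x)⁻¹ : ℝ) : ℂ) *
      (Complex.exp (Complex.I * φ x) * (Complex.I * φ' x))
      = ∫ x in a..b, Complex.exp (Complex.I * φ x) := by
    apply integral_congr
    intro x hx
    rw [Set.uIcc_of_le hab] at hx
    have : (φ' x : ℂ) ≠ 0 := by exact_mod_cast hne x hx
    push_cast
    field_simp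
    linear_combination (-1 : ℂ) * Complex.I_sq
  rw [hL] at hibp
  have hnorm : ∀ x : ℝ, ‖Complex.exp (Complex.I * x)‖ = 1 := by
    intro x; rw [mul_comm]; exact Complex.norm_exp_ofReal_mul_I x
  have hI : ‖∫ x in a..b, -Complex.I * ((-φ'' x / φ' x ^ 2 : ℝ) : ℂ) *
      Complex.exp (Complex.I * φ x)‖ ≤ 1 / μ := by
    have e1 : ‖∫ x in a..b, -Complex.I * ((-φ'' x / φ' x ^ 2 : ℝ) : ℂ) *
        Complex.exp (Complex.I * φ x)‖ ≤ ∫ x in a..b, -(-φ'' x / φ' x ^ 2) := by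
      apply norm_integral_le_of_norm_le hab _ (hcd.neg.intervalIntegrable_of_Icc hab)
      refine Filter.Eventually.of_forall fun x hx => ?_
      have hx' : x ∈ Set.Icc a b := Set.Ioc_subset_Icc_self hx
      rw [norm_mul, norm_mul, hnorm, norm_neg, Complex.norm_I, Complex.norm_real, one_mul, mul_one,
        Real.norm_eq_abs, neg_div, abs_neg, abs_of_nonneg]
      · simp [neg_div]
      exact div_nonneg (h4 x hx') (sq_nonneg _)
    have e2 : ∫ x in a..b, -(-φ'' x / φ' x ^ 2) = (φ' a)⁻¹ - (φ' b)⁻¹ := by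
      rw [intervalIntegral.integral_neg, integral_eq_sub_of_hasDerivAt
        (fun x hx => hd1 x (by rwa [Set.uIcc_of_le hab] at hx)) (hcd.intervalIntegrable_of_Icc hab)]
      ring
    have ha : a ∈ Set.Icc a b := Set.left_mem_Icc.2 hab
    have hb : b ∈ Set.Icc a b := Set.right_mem_Icc.2 hab
    rw [e2] at e1
    refine e1.trans ?_
    rcases h5 with h | h
    · have e3 : 0 ≤ (φ' b)⁻¹ := inv_nonneg.2 (hμ.le.trans (h b hb))
      have := (le_abs_self _).trans (hinv a ha)
      linarith
    · have e3 : (φ' a)⁻¹ ≤ 0 := inv_nonpos.2 (by linarith [h a ha])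
      have := (neg_le_abs _).trans (hinv b hb)
      linarith
  have hB : ∀ x ∈ Set.Icc a b, ‖-Complex.I * (((φ' x)⁻¹ : ℝ) : ℂ) *
      Complex.exp (Complex.I * φ x)‖ ≤ 1 / μ := by
    intro x hx
    rw [norm_mul, norm_mul, hnorm, norm_neg, Complex.norm_I, Complex.norm_real, one_mul, mul_one]
    exact hinv x hx
  rw [hibp]
  refine (norm_sub_le _ _).trans ?_
  have := norm_sub_le
    (-Complex.I * (((φ' b)⁻¹ : ℝ) : ℂ) * Complex.exp (Complex.I * φ b))
    (-Complex.I * (((φ' a)⁻¹ : ℝ) : ℂ) * Complex.exp (Complex.I * φ a))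
  have b1 := hB b (Set.right_mem_Icc.2 hab)
  have b2 := hB a (Set.left_mem_Icc.2 hab)
  have : 3 / μ = 1 / μ + 1 / μ + 1 / μ := by ring
  linarith

/-- A function whose derivative is at least `μ` grows at rate at least `μ` away from its zero, or
away from an endpoint if it has none. -/
theorem exists_forall_mul_sub_le {f f' : ℝ → ℝ} {a b μ : ℝ} (hab : a ≤ b)
    (h1 : ∀ x ∈ Set.Icc a b, HasDerivAt f (f' x) x) (h2 : ∀ x ∈ Set.Icc a b, μ ≤ f' x) :
    ∃ c ∈ Set.Icc a b, (∀ x ∈ Set.Ioc c b, μ * (x - c) ≤ f x) ∧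
      ∀ x ∈ Set.Ico a c, f x ≤ -(μ * (c - x)) := by
  have hc : ContinuousOn f (Set.Icc a b) := fun x hx => (h1 x hx).continuousAt.continuousWithinAt
  have hmono : ∀ x ∈ Set.Icc a b, ∀ y ∈ Set.Icc a b, x ≤ y → μ * (y - x) ≤ f y - f x := by
    apply (convex_Icc a b).mul_sub_le_image_sub_of_le_deriv hc
    · intro x hx
      exact (h1 x (interior_subset hx)).differentiableAt.differentiableWithinAt
    · intro x hx
      rw [(h1 x (interior_subset hx)).deriv]
      exact h2 x (interior_subset hx)
  have ha : a ∈ Set.Icc a b := Set.left_mem_Icc.2 hab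
  have hb : b ∈ Set.Icc a b := Set.right_mem_Icc.2 hab
  rcases le_total 0 (f a) with h | h
  · refine ⟨a, ha, fun x hx => ?_, fun x hx => absurd hx.2 (not_lt.2 hx.1)⟩
    linarith [hmono a ha x (Set.Ioc_subset_Icc_self hx) hx.1.le]
  rcases le_total (f b) 0 with h' | h'
  · refine ⟨b, hb, fun x hx => absurd hx.1 (not_lt.2 hx.2), fun x hx => ?_⟩
    linarith [hmono x (Set.Ico_subset_Icc_self hx) b hb hx.2.le]
  obtain ⟨c, hc, hc0⟩ := intermediate_value_Icc hab hc ⟨h, h'⟩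
  refine ⟨c, hc, fun x hx => ?_, fun x hx => ?_⟩
  · linarith [hmono c hc x ⟨hc.1.trans hx.1.le, hx.2⟩ hx.1.le]
  · linarith [hmono x ⟨hx.1, hx.2.le.trans hc.2⟩ c hc hx.2.le]

/-- Second derivative test.  The first derivative test applies outside an interval of length
`2 / √μ` around the stationary point, and inside that interval the length bounds the integral. -/
theorem norm_integral_cexp_le_of_deriv2 {φ φ' φ'' : ℝ → ℝ} {a b μ : ℝ} (hab : a ≤ b) (hμ : 0 < μ)
    (h1 : ∀ x ∈ Set.Icc a b, HasDerivAt φ (φ' x) x)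
    (h2 : ∀ x ∈ Set.Icc a b, HasDerivAt φ' (φ'' x) x)
    (h3 : ContinuousOn φ'' (Set.Icc a b)) (h4 : ∀ x ∈ Set.Icc a b, μ ≤ φ'' x) :
    ‖∫ x in a..b, Complex.exp (Complex.I * φ x)‖ ≤ 8 / √μ := by
  obtain ⟨c, hc, hc1, hc2⟩ := exists_forall_mul_sub_le hab h2 h4
  have hs : 0 < √μ := Real.sqrt_pos.2 hμ
  have hss : √μ * √μ = μ := Real.mul_self_sqrt hμ.le
  set δ : ℝ := 1 / √μ with hδ
  have hδ0 : 0 < δ := by positivity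
  have hμδ : μ * δ = √μ := by rw [hδ]; field_simp; linarith
  set p := max a (c - δ) with hp
  set q := min b (c + δ) with hq
  have hap : a ≤ p := le_max_left _ _
  have hpc : p ≤ c := max_le hc.1 (by linarith)
  have hcq : c ≤ q := le_min hc.2 (by linarith)
  have hqb : q ≤ b := min_le_left _ _
  have hcφ : ContinuousOn φ (Set.Icc a b) := fun x hx => (h1 x hx).continuousAt.continuousWithinAt
  have hce : ContinuousOn (fun x => Complex.exp (Complex.I * φ x)) (Set.Icc a b) :=
    (continuousOn_const.mul (Complex.continuous_ofReal.comp_continuousOn hcφ)).cexp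
  have hint : ∀ u v, a ≤ u → u ≤ v → v ≤ b →
      IntervalIntegrable (fun x => Complex.exp (Complex.I * φ x)) volume u v :=
    fun u v hu huv hv => (hce.mono (Set.Icc_subset_Icc hu hv)).intervalIntegrable_of_Icc huv
  have hsplit : ∫ x in a..b, Complex.exp (Complex.I * φ x)
      = (∫ x in a..p, Complex.exp (Complex.I * φ x)) + (∫ x in p..q, Complex.exp (Complex.I * φ x))
        + ∫ x in q..b, Complex.exp (Complex.I * φ x) := by
    rw [intervalIntegral.integral_add_adjacent_intervals (hint _ _ le_rfl hap (by linarith))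
      (hint _ _ hap (by linarith) hqb),
      intervalIntegral.integral_add_adjacent_intervals (hint _ _ le_rfl (by linarith) hqb)
      (hint _ _ (by linarith) hqb le_rfl)]
  have hleft : ‖∫ x in a..p, Complex.exp (Complex.I * φ x)‖ ≤ 3 / √μ := by
    rcases le_total (c - δ) a with h | h
    · rw [hp, max_eq_left h, intervalIntegral.integral_same, norm_zero]; positivity
    · have hpe : p = c - δ := max_eq_right h
      have hsub : Set.Icc a p ⊆ Set.Icc a b := Set.Icc_subset_Icc le_rfl (by linarith)
      refine norm_integral_cexp_le_of_deriv hap hs (fun x hx => h1 x (hsub hx))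
        (fun x hx => h2 x (hsub hx)) (h3.mono hsub) (fun x hx => hμ.le.trans (h4 x (hsub hx)))
        (Or.inr fun x hx => ?_)
      have hxp := hx.2
      have e1 := hc2 x ⟨hx.1, by linarith⟩
      have e2 : μ * δ ≤ μ * (c - x) := mul_le_mul_of_nonneg_left (by linarith) hμ.le
      linarith
  have hright : ‖∫ x in q..b, Complex.exp (Complex.I * φ x)‖ ≤ 3 / √μ := by
    rcases le_total b (c + δ) with h | h
    · rw [hq, min_eq_left h, intervalIntegral.integral_same, norm_zero]; positivity
    · have hqe : q = c + δ := min_eq_right h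
      have hsub : Set.Icc q b ⊆ Set.Icc a b := Set.Icc_subset_Icc (by linarith) le_rfl
      refine norm_integral_cexp_le_of_deriv hqb hs (fun x hx => h1 x (hsub hx))
        (fun x hx => h2 x (hsub hx)) (h3.mono hsub) (fun x hx => hμ.le.trans (h4 x (hsub hx)))
        (Or.inl fun x hx => ?_)
      have hxp := hx.1
      have e1 := hc1 x ⟨by linarith, hx.2⟩
      have e2 : μ * δ ≤ μ * (x - c) := mul_le_mul_of_nonneg_left (by linarith) hμ.le
      linarith
  have hmid : ‖∫ x in p..q, Complex.exp (Complex.I * φ x)‖ ≤ 2 / √μ := by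
    have e := intervalIntegral.norm_integral_le_of_norm_le_const (a := p) (b := q) (C := 1)
      (f := fun x => Complex.exp (Complex.I * φ x)) fun x _ => by
        rw [mul_comm]; exact (Complex.norm_exp_ofReal_mul_I _).le
    refine e.trans ?_
    have e1 : p ≥ c - δ := le_max_right _ _
    have e2 : q ≤ c + δ := min_le_right _ _
    rw [abs_of_nonneg (by linarith)]
    have : 2 / √μ = 2 * δ := by rw [hδ]; ring
    linarith
  rw [hsplit]
  refine (norm_add₃_le).trans ?_
  have : 8 / √μ = 3 / √μ + 2 / √μ + 3 / √μ := by ring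
  linarith

/-- A bound for the oscillatory integral on all initial intervals passes to amplitudes vanishing at
the right endpoint, by integration by parts. -/
theorem norm_integral_mul_le_of_forall_norm_integral_le {e ψ ψ' : ℝ → ℂ} {a b K D : ℝ}
    (hab : a ≤ b) (he : Continuous e)
    (hK : ∀ x ∈ Set.Icc a b, ‖∫ y in a..x, e y‖ ≤ K)
    (h1 : ∀ x ∈ Set.Icc a b, HasDerivAt ψ (ψ' x) x) (h2 : ContinuousOn ψ' (Set.Icc a b))
    (h3 : ψ b = 0) (h4 : ∀ x ∈ Set.Icc a b, ‖ψ' x‖ ≤ D) :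
    ‖∫ x in a..b, e x * ψ x‖ ≤ K * D * (b - a) := by
  have hF : ∀ x ∈ Set.uIcc a b, HasDerivAt (fun z => ∫ y in a..z, e y) (e x) x := fun x _ =>
    intervalIntegral.integral_hasDerivAt_right (he.intervalIntegrable _ _)
      he.aestronglyMeasurable.stronglyMeasurableAtFilter he.continuousAt
  have hibp := intervalIntegral.integral_mul_deriv_eq_deriv_mul
    (fun x hx => h1 x (by rwa [Set.uIcc_of_le hab] at hx)) hF
    (h2.intervalIntegrable_of_Icc hab) (he.intervalIntegrable _ _)
  have : ∫ x in a..b, e x * ψ x = ∫ x in a..b, ψ x * e x := by simp only [mul_comm]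
  rw [this, hibp, h3, intervalIntegral.integral_same, zero_mul, mul_zero, sub_zero, zero_sub,
    norm_neg]
  have hD : 0 ≤ D := (norm_nonneg _).trans (h4 a (Set.left_mem_Icc.2 hab))
  have := intervalIntegral.norm_integral_le_of_norm_le_const (a := a) (b := b) (C := K * D)
    (f := fun x => ψ' x * ∫ y in a..x, e y) fun x hx => by
      rw [Set.uIoc_of_le hab] at hx
      have hx := Set.Ioc_subset_Icc_self hx
      rw [norm_mul, mul_comm]
      exact mul_le_mul (hK x hx) (h4 x hx) (norm_nonneg _) ((norm_nonneg _).trans (hK x hx))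
  rwa [abs_of_nonneg (by linarith)] at this

/-! ### The dispersion relation -/

/-- The radial profile `m(r) = √(r tanh r)` of the dispersion relation. -/
noncomputable def waveFreq (r : ℝ) : ℝ := √(r * Real.tanh r)

/-- The derivative of `waveFreq` on `(0, ∞)`. -/
noncomputable def waveFreq' (r : ℝ) : ℝ :=
  (Real.tanh r + r * (1 - Real.tanh r ^ 2)) / (2 * waveFreq r)

/-- The second derivative of `waveFreq` on `(0, ∞)`, in a form that exhibits its sign. -/
noncomputable def waveFreq'' (r : ℝ) : ℝ :=
  -((Real.tanh r - r * (1 - Real.tanh r ^ 2)) ^ 2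
    + 4 * r ^ 2 * Real.tanh r ^ 2 * (1 - Real.tanh r ^ 2)) / (4 * waveFreq r ^ 3)

theorem hasDerivAt_real_tanh (r : ℝ) : HasDerivAt Real.tanh (1 - Real.tanh r ^ 2) r := by
  have h := (Real.hasDerivAt_sinh r).div (Real.hasDerivAt_cosh r) (Real.cosh_pos r).ne'
  have e : Real.tanh = fun y => Real.sinh y / Real.cosh y := by
    funext y; exact Real.tanh_eq_sinh_div_cosh y
  have hc := (Real.cosh_pos r).ne'
  rw [e]
  convert! h using 1
  field_simp

theorem continuous_real_tanh : Continuous Real.tanh :=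
  continuous_iff_continuousAt.2 fun r => (hasDerivAt_real_tanh r).continuousAt

theorem continuous_waveFreq : Continuous waveFreq :=
  (continuous_id.mul continuous_real_tanh).sqrt

theorem real_tanh_pos {r : ℝ} (hr : 0 < r) : 0 < Real.tanh r := by
  rw [Real.tanh_eq_sinh_div_cosh]
  exact div_pos (Real.sinh_pos_iff.2 hr) (Real.cosh_pos r)

theorem real_one_sub_tanh_sq (r : ℝ) : 1 - Real.tanh r ^ 2 = 1 / Real.cosh r ^ 2 := by
  have hc := (Real.cosh_pos r).ne'
  rw [Real.tanh_eq_sinh_div_cosh]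
  field_simp
  linarith [Real.cosh_sq r]

theorem real_tanh_lt_one (r : ℝ) : Real.tanh r < 1 := by
  have h := real_one_sub_tanh_sq r
  have : 0 < 1 / Real.cosh r ^ 2 := by have := Real.cosh_pos r; positivity
  nlinarith

theorem waveFreq_pos {r : ℝ} (hr : 0 < r) : 0 < waveFreq r :=
  Real.sqrt_pos.2 (mul_pos hr (real_tanh_pos hr))

theorem waveFreq_sq {r : ℝ} (hr : 0 < r) : waveFreq r ^ 2 = r * Real.tanh r :=
  Real.sq_sqrt (mul_pos hr (real_tanh_pos hr)).le

theorem hasDerivAt_waveFreq {r : ℝ} (hr : 0 < r) : HasDerivAt waveFreq (waveFreq' r) r := by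
  have h := ((hasDerivAt_id r).mul (hasDerivAt_real_tanh r)).sqrt
    (mul_pos hr (real_tanh_pos hr)).ne'
  convert! h using 1
  simp [waveFreq', waveFreq]

theorem hasDerivAt_waveFreq' {r : ℝ} (hr : 0 < r) : HasDerivAt waveFreq' (waveFreq'' r) r := by
  have hT := hasDerivAt_real_tanh r
  have hm := hasDerivAt_waveFreq hr
  have hp := (waveFreq_pos hr).ne'
  have h := (hT.add ((hasDerivAt_id r).mul ((hT.pow 2).const_sub 1))).div (hm.const_mul 2)
    (mul_ne_zero two_ne_zero hp)
  convert! h using 1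
  simp only [waveFreq'', waveFreq', id]
  have hs := waveFreq_sq hr
  have hT0 := (real_tanh_pos hr).ne'
  set T := Real.tanh r
  set m := waveFreq r
  simp
  field_simp
  rw [hs]
  ring

theorem continuousOn_waveFreq'' : ContinuousOn waveFreq'' (Set.Ioi 0) := by
  unfold waveFreq''
  have h1 := continuous_real_tanh
  have h2 := continuous_waveFreq
  refine ContinuousOn.div (by fun_prop) (by fun_prop) fun r hr => ?_
  have := waveFreq_pos hr
  positivity

theorem waveFreq_le_sqrt {r : ℝ} (hr : 0 < r) : waveFreq r ≤ √r :=
  Real.sqrt_le_sqrt (by nlinarith [real_tanh_lt_one r])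

theorem three_halves_le_cosh {r : ℝ} (hr : 1 ≤ r) : 3 / 2 ≤ Real.cosh r := by
  have h1 := Real.cosh_two_mul (r / 2)
  have h2 : r / 2 ≤ Real.sinh (r / 2) := Real.self_le_sinh_iff.2 (by linarith)
  rw [mul_div_cancel₀ r two_ne_zero, Real.cosh_sq] at h1
  nlinarith

theorem le_tanh_sq {r : ℝ} (hr : 1 ≤ r) : 5 / 9 ≤ Real.tanh r ^ 2 := by
  have h := real_one_sub_tanh_sq r
  have hc := three_halves_le_cosh hr
  have : 1 / Real.cosh r ^ 2 ≤ 1 / (3 / 2) ^ 2 := by gcongr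
  linarith

theorem le_waveFreq' {r : ℝ} (hr : 1 ≤ r) : 5 / 18 / √r ≤ waveFreq' r := by
  have hr0 : 0 < r := by linarith
  have hT := le_tanh_sq hr
  have hT1 := real_tanh_lt_one r
  have hT0 := real_tanh_pos hr0
  have hs := Real.sqrt_pos.2 hr0
  have hm := waveFreq_pos hr0
  have hms := waveFreq_le_sqrt hr0
  rw [waveFreq', div_le_div_iff₀ hs (by positivity)]
  have h1 : 5 / 9 ≤ Real.tanh r := by nlinarith
  have h2 : 0 ≤ r * (1 - Real.tanh r ^ 2) := by
    rw [real_one_sub_tanh_sq]; positivity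
  calc 5 / 18 * (2 * waveFreq r) ≤ 5 / 9 * √r := by linarith
    _ ≤ _ := by gcongr; linarith

theorem le_neg_waveFreq'' {r : ℝ} (hr : 1 ≤ r) : 5 / 324 / √r ^ 3 ≤ -waveFreq'' r := by
  have hr0 : 0 < r := by linarith
  have hT := le_tanh_sq hr
  have hT0 := real_tanh_pos hr0
  have hs := Real.sqrt_pos.2 hr0
  have hm := waveFreq_pos hr0
  have hms := waveFreq_le_sqrt hr0
  have hc := three_halves_le_cosh hr
  have hc0 := Real.cosh_pos r
  have hsh : r ≤ Real.sinh r := Real.self_le_sinh_iff.2 hr0.le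
  have h1 : Real.tanh r * (1 / 3) ≤ Real.tanh r - r * (1 - Real.tanh r ^ 2) := by
    have e1 : r * (1 - Real.tanh r ^ 2) ≤ Real.tanh r * (2 / 3) := by
      rw [real_one_sub_tanh_sq, Real.tanh_eq_sinh_div_cosh, mul_one_div, div_mul_eq_mul_div,
        div_le_div_iff₀ (by positivity) hc0]
      have e2 : r * Real.cosh r ≤ Real.sinh r * Real.cosh r := by gcongr
      have e3 : 0 ≤ Real.sinh r * Real.cosh r := by
        have : 0 ≤ Real.sinh r := hr0.le.trans hsh
        positivity
      nlinarith
    linarith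
  have h2 : 5 / 81 ≤ (Real.tanh r - r * (1 - Real.tanh r ^ 2)) ^ 2
      + 4 * r ^ 2 * Real.tanh r ^ 2 * (1 - Real.tanh r ^ 2) := by
    have e1 : (Real.tanh r * (1 / 3)) ^ 2 ≤ (Real.tanh r - r * (1 - Real.tanh r ^ 2)) ^ 2 := by
      gcongr
    have e2 : 0 ≤ 4 * r ^ 2 * Real.tanh r ^ 2 * (1 - Real.tanh r ^ 2) := by
      rw [real_one_sub_tanh_sq]; positivity
    nlinarith
  rw [waveFreq'', neg_div, neg_neg, div_le_div_iff₀ (by positivity) (by positivity)]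
  calc 5 / 324 * (4 * waveFreq r ^ 3) = 5 / 81 * waveFreq r ^ 3 := by ring
    _ ≤ _ := by gcongr

theorem norm_integral_cexp_neg (φ : ℝ → ℝ) (a b : ℝ) :
    ‖∫ x in a..b, Complex.exp (Complex.I * (-φ x : ℝ))‖
      = ‖∫ x in a..b, Complex.exp (Complex.I * φ x)‖ := by
  rw [← RCLike.norm_conj (∫ x in a..b, Complex.exp (Complex.I * φ x)),
    ← intervalIntegral.intervalIntegral_conj]
  congr 2
  funext x
  rw [← Complex.exp_conj]
  simp

/-- The radial phase `y r - τ m(r)`. -/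
noncomputable def radialPhase (y τ r : ℝ) : ℝ := y * r - τ * waveFreq r

theorem hasDerivAt_radialPhase (y τ : ℝ) {r : ℝ} (hr : 0 < r) :
    HasDerivAt (radialPhase y τ) (y - τ * waveFreq' r) r := by
  convert! ((hasDerivAt_id r).const_mul y).sub ((hasDerivAt_waveFreq hr).const_mul τ) using 1
  simp

theorem hasDerivAt_radialPhase' (y τ : ℝ) {r : ℝ} (hr : 0 < r) :
    HasDerivAt (fun r => y - τ * waveFreq' r) (-(τ * waveFreq'' r)) r :=
  ((hasDerivAt_waveFreq' hr).const_mul τ).const_sub y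

theorem continuous_cexp_radialPhase (y τ : ℝ) :
    Continuous fun r => Complex.exp (Complex.I * radialPhase y τ r) := by
  have := continuous_waveFreq
  unfold radialPhase
  fun_prop

theorem norm_cexp_radialPhase (y τ r : ℝ) :
    ‖Complex.exp (Complex.I * radialPhase y τ r)‖ = 1 := by
  rw [mul_comm]; exact Complex.norm_exp_ofReal_mul_I _

/-- Concavity of the dispersion relation: a bound for the radial integral without amplitude that is
uniform in the linear part of the phase. -/
theorem norm_integral_cexp_radialPhase_le {lam τ y x : ℝ} (hlam : 2 ≤ lam) (hτ : τ ≠ 0)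
    (hx : x ∈ Set.Icc (lam / 2) (2 * lam)) :
    ‖∫ r in lam / 2..x, Complex.exp (Complex.I * radialPhase y τ r)‖
      ≤ 8 / √(|τ| * (1 / 200 / √lam ^ 3)) := by
  wlog h : 0 < τ generalizing τ y
  · have := this (τ := -τ) (y := -y) (neg_ne_zero.2 hτ)
      (neg_pos.2 (lt_of_le_of_ne (not_lt.1 h) hτ))
    rw [abs_neg] at this
    rw [← norm_integral_cexp_neg]
    convert this using 6
    simp only [radialPhase]
    ring_nf
  have hs : 0 < √lam := Real.sqrt_pos.2 (by linarith)
  have h0 : ∀ r ∈ Set.Icc (lam / 2) x, 0 < r := fun r hr => by linarith [hr.1]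
  have h1 : ∀ r ∈ Set.Icc (lam / 2) x, 1 ≤ r := fun r hr => by linarith [hr.1]
  rw [abs_of_pos h]
  refine norm_integral_cexp_le_of_deriv2 hx.1 (by positivity)
    (fun r hr => hasDerivAt_radialPhase y τ (h0 r hr))
    (fun r hr => hasDerivAt_radialPhase' y τ (h0 r hr))
    ((continuousOn_const.mul (continuousOn_waveFreq''.mono h0)).neg) fun r hr => ?_
  rw [← mul_neg]
  refine mul_le_mul_of_nonneg_left ((le_trans ?_ (le_neg_waveFreq'' (h1 r hr)))) h.le
  have hr0 := h0 r hr
  have hsr : √r ≤ √2 * √lam := by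
    rw [← Real.sqrt_mul (by norm_num)]
    exact Real.sqrt_le_sqrt (hr.2.trans hx.2)
  have h2 : √2 ^ 3 ≤ 3 := by
    have e1 : √2 ^ 2 = 2 := Real.sq_sqrt (by norm_num)
    have e2 : √2 ≤ 3 / 2 := Real.sqrt_le_iff.2 (by norm_num)
    calc √2 ^ 3 = √2 ^ 2 * √2 := by ring
      _ ≤ 3 := by rw [e1]; linarith
  have hsr0 := Real.sqrt_pos.2 hr0
  have h3 : √r ^ 3 ≤ 3 * √lam ^ 3 := by
    calc √r ^ 3 ≤ (√2 * √lam) ^ 3 := by gcongr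
      _ = √2 ^ 3 * √lam ^ 3 := by ring
      _ ≤ _ := by gcongr
  rw [div_le_div_iff₀ (by positivity) (by positivity)]
  nlinarith [pow_pos hs 3]

/-- A lower bound for the group velocity: away from the light cone the radial integral without
amplitude decays at the faster rate of the first derivative test. -/
theorem norm_integral_cexp_radialPhase_le_of_abs_le {lam τ y x : ℝ} (hlam : 2 ≤ lam) (hτ : τ ≠ 0)
    (hy : |y| ≤ |τ| * (1 / 10 / √lam)) (hx : x ∈ Set.Icc (lam / 2) (2 * lam)) :
    ‖∫ r in lam / 2..x, Complex.exp (Complex.I * radialPhase y τ r)‖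
      ≤ 3 / (|τ| * (9 / 100 / √lam)) := by
  wlog h : 0 < τ generalizing τ y
  · have := this (τ := -τ) (y := -y) (neg_ne_zero.2 hτ) (by simpa using hy)
      (neg_pos.2 (lt_of_le_of_ne (not_lt.1 h) hτ))
    rw [abs_neg] at this
    rw [← norm_integral_cexp_neg]
    convert this using 6
    simp only [radialPhase]
    ring_nf
  have hs : 0 < √lam := Real.sqrt_pos.2 (by linarith)
  have h0 : ∀ r ∈ Set.Icc (lam / 2) x, 0 < r := fun r hr => by linarith [hr.1]
  have h1 : ∀ r ∈ Set.Icc (lam / 2) x, 1 ≤ r := fun r hr => by linarith [hr.1]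
  rw [abs_of_pos h] at hy ⊢
  refine norm_integral_cexp_le_of_deriv hx.1 (by positivity)
    (fun r hr => hasDerivAt_radialPhase y τ (h0 r hr))
    (fun r hr => hasDerivAt_radialPhase' y τ (h0 r hr))
    ((continuousOn_const.mul (continuousOn_waveFreq''.mono h0)).neg) (fun r hr => ?_)
    (Or.inr fun r hr => ?_)
  · rw [← mul_neg]
    refine mul_nonneg h.le ((le_trans ?_ (le_neg_waveFreq'' (h1 r hr))))
    positivity
  have hr0 := h0 r hr
  have hsr : √r ≤ √2 * √lam := by
    rw [← Real.sqrt_mul (by norm_num)]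
    exact Real.sqrt_le_sqrt (hr.2.trans hx.2)
  have h2 : √2 ≤ 71 / 50 := Real.sqrt_le_iff.2 (by norm_num)
  have hsr0 := Real.sqrt_pos.2 hr0
  have h3 : 19 / 100 / √lam ≤ waveFreq' r := by
    refine le_trans ?_ (le_waveFreq' (h1 r hr))
    rw [div_le_div_iff₀ (by positivity) (by positivity)]
    nlinarith
  have h4 : τ * (19 / 100 / √lam) ≤ τ * waveFreq' r := by gcongr
  have h5 := (le_abs_self y).trans hy
  have h6 : τ * (19 / 100 / √lam) = τ * (1 / 10 / √lam) + τ * (9 / 100 / √lam) := by ring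
  linarith

/-! ### The Fourier transform of the circle -/

/-- The moments `∫ cosᵏ θ e^{i z cos θ} dθ` over the circle.  The one with `k = 0` is `2π J₀(z)`. -/
noncomputable def besselMoment (k : ℕ) (z : ℝ) : ℂ :=
  ∫ θ in -Real.pi..Real.pi, (Real.cos θ : ℂ) ^ k * Complex.exp (Complex.I * (z * Real.cos θ : ℝ))

theorem hasDerivAt_besselMoment (k : ℕ) (z : ℝ) :
    HasDerivAt (besselMoment k) (Complex.I * besselMoment (k + 1) z) z := by
  have hc := Real.continuous_cos
  have h := intervalIntegral.hasDerivAt_integral_of_dominated_loc_of_deriv_le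
    (F := fun z θ => (Real.cos θ : ℂ) ^ k * Complex.exp (Complex.I * (z * Real.cos θ : ℝ)))
    (F' := fun z θ => Complex.I *
      ((Real.cos θ : ℂ) ^ (k + 1) * Complex.exp (Complex.I * (z * Real.cos θ : ℝ))))
    (x₀ := z) (a := -Real.pi) (b := Real.pi) (μ := volume) (bound := fun _ => 1)
    (s := Set.univ) Filter.univ_mem
    (Filter.Eventually.of_forall fun x => by
      apply Continuous.aestronglyMeasurable; fun_prop)
    (by apply Continuous.intervalIntegrable; fun_prop)
    (by apply Continuous.aestronglyMeasurable; fun_prop)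
    (Filter.Eventually.of_forall fun θ _ x _ => by
      rw [norm_mul, norm_mul, Complex.norm_I, mul_comm Complex.I, Complex.norm_exp_ofReal_mul_I,
        norm_pow, Complex.norm_real, one_mul, mul_one]
      exact pow_le_one₀ (norm_nonneg _) (Real.abs_cos_le_one θ))
    (by simp)
    (Filter.Eventually.of_forall fun θ _ x _ => by
      have h1 : HasDerivAt (fun z : ℝ => z * Real.cos θ) (Real.cos θ) x := by
        simpa using (hasDerivAt_id x).mul_const (Real.cos θ)
      convert! ((h1.ofReal_comp.const_mul Complex.I).cexp).const_mul ((Real.cos θ : ℂ) ^ k) using 1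
      ring)
  have h2 := h.2
  rw [intervalIntegral.integral_const_mul] at h2
  exact h2

theorem continuous_besselMoment (k : ℕ) : Continuous (besselMoment k) :=
  continuous_iff_continuousAt.2 fun z => (hasDerivAt_besselMoment k z).continuousAt

/-- Bessel's equation, in terms of the moments. -/
theorem besselMoment_eq (z : ℝ) :
    Complex.I * z * (besselMoment 0 z - besselMoment 2 z) = besselMoment 1 z := by
  have hc := Real.continuous_cos
  have hsn := Real.continuous_sin
  have h := intervalIntegral.integral_mul_deriv_eq_deriv_mul (a := -Real.pi) (b := Real.pi)
    (u := fun θ : ℝ => (Real.sin θ : ℂ)) (u' := fun θ : ℝ => (Real.cos θ : ℂ))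
    (v := fun θ : ℝ => Complex.exp (Complex.I * (z * Real.cos θ : ℝ)))
    (v' := fun θ : ℝ => Complex.exp (Complex.I * (z * Real.cos θ : ℝ)) *
      (Complex.I * (z * -Real.sin θ : ℝ)))
    (fun θ _ => (Real.hasDerivAt_sin θ).ofReal_comp)
    (fun θ _ => ((((Real.hasDerivAt_cos θ).const_mul z).ofReal_comp).const_mul Complex.I).cexp)
    (by apply Continuous.intervalIntegrable; fun_prop)
    (by apply Continuous.intervalIntegrable; fun_prop)
  simp only [Real.sin_pi, Real.sin_neg, neg_zero, Complex.ofReal_zero, zero_mul, sub_zero,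
    zero_sub] at h
  have h1 : besselMoment 1 z = ∫ θ in -Real.pi..Real.pi,
      (Real.cos θ : ℂ) * Complex.exp (Complex.I * (z * Real.cos θ : ℝ)) := by
    simp only [besselMoment, pow_one]
  have h2 : besselMoment 0 z - besselMoment 2 z = ∫ θ in -Real.pi..Real.pi,
      (Real.sin θ : ℂ) ^ 2 * Complex.exp (Complex.I * (z * Real.cos θ : ℝ)) := by
    rw [besselMoment, besselMoment, ← intervalIntegral.integral_sub]
    · congr 1
      funext θ
      have : (Real.sin θ : ℂ) ^ 2 = 1 - (Real.cos θ : ℂ) ^ 2 := by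
        have := Real.sin_sq θ
        exact_mod_cast this
      rw [this]; ring
    · apply Continuous.intervalIntegrable; fun_prop
    · apply Continuous.intervalIntegrable; fun_prop
  rw [h2, h1, ← neg_neg (∫ θ in -Real.pi..Real.pi,
      (Real.cos θ : ℂ) * Complex.exp (Complex.I * (z * Real.cos θ : ℝ))), ← h,
    ← intervalIntegral.integral_neg, ← intervalIntegral.integral_const_mul]
  congr 1
  funext θ
  push_cast
  ring

/-- `z^{-1/2} (z^{1/2} B)'`, where `B = besselMoment 0`.  In the pair `(B, besselAux)` Bessel's
equation is a rotation up to the damping `-1/(2z)` and an error `O(z⁻²)`. -/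
noncomputable def besselAux (z : ℝ) : ℂ :=
  Complex.I * besselMoment 1 z + besselMoment 0 z / (2 * z)

theorem hasDerivAt_besselMoment_zero (z : ℝ) :
    HasDerivAt (besselMoment 0) (besselAux z - besselMoment 0 z / (2 * z)) z := by
  convert! hasDerivAt_besselMoment 0 z using 1
  simp [besselAux]

theorem hasDerivAt_besselAux {z : ℝ} (hz : 0 < z) :
    HasDerivAt besselAux (-besselMoment 0 z - besselAux z / (2 * z)
      - besselMoment 0 z / (4 * z ^ 2)) z := by
  have hz' : (z : ℂ) ≠ 0 := by exact_mod_cast hz.ne'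
  have h1 := (hasDerivAt_besselMoment 1 z).const_mul Complex.I
  have h2 : HasDerivAt (fun z : ℝ => (2 * z : ℂ)) 2 z := by
    simpa using ((hasDerivAt_id z).ofReal_comp).const_mul (2 : ℂ)
  have h3 := h1.add ((hasDerivAt_besselMoment 0 z).div h2 (by simpa using hz'))
  convert! h3 using 1
  have h := besselMoment_eq z
  simp only [besselAux, zero_add, Nat.reduceAdd]
  rw [← h]
  field_simp
  ring_nf
  simp only [Complex.I_sq]
  ring

/-- The energy `z (|B|² + |P|²)` of Bessel's equation stays bounded. -/
theorem exists_norm_besselMoment_le : ∃ C : ℝ, 0 < C ∧ ∀ z : ℝ, 1 ≤ z →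
    ‖besselMoment 0 z‖ ≤ C / √z ∧ ‖besselAux z‖ ≤ C / √z := by
  set E : ℝ → ℝ := fun z => z * (‖besselMoment 0 z‖ ^ 2 + ‖besselAux z‖ ^ 2) with hE
  have hEd : ∀ z : ℝ, 0 < z →
      HasDerivAt E (-(inner ℝ (besselAux z) (besselMoment 0 z)) / (2 * z)) z := by
    intro z hz
    have h1 := (hasDerivAt_besselMoment_zero z).norm_sq
    have h2 := (hasDerivAt_besselAux hz).norm_sq
    convert! (hasDerivAt_id z).mul (h1.add h2) using 1
    simp only [Complex.inner, ← Complex.normSq_eq_norm_sq, Complex.normSq_apply]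
    obtain ⟨c, hc⟩ : ∃ c : ℝ, c = 1 / (2 * z) := ⟨_, rfl⟩
    obtain ⟨d, hd⟩ : ∃ d : ℝ, d = 1 / (4 * z ^ 2) := ⟨_, rfl⟩
    have e1 : ∀ w : ℂ, w / (2 * z) = (c : ℂ) * w := by
      intro w; rw [hc]; push_cast; ring
    have e2 : ∀ w : ℂ, w / (4 * z ^ 2) = (d : ℂ) * w := by
      intro w; rw [hd]; push_cast; ring
    rw [e1, e1, e2]
    simp
    rw [hc, hd]
    field_simp
    ring
  -- the derivative of `E` is at most `E / (4 z²)`, and the factor turns this into monotonicity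
  set F : ℝ → ℝ := fun z => E z * Real.exp (1 / (4 * z)) with hF
  have hFd : ∀ z : ℝ, 0 < z → HasDerivAt F
      ((-(inner ℝ (besselAux z) (besselMoment 0 z)) / (2 * z) - E z / (4 * z ^ 2))
        * Real.exp (1 / (4 * z))) z := by
    intro z hz
    have h1 : HasDerivAt (fun z : ℝ => 1 / (4 * z)) (-(1 / (4 * z ^ 2))) z := by
      have := ((hasDerivAt_id z).const_mul 4).inv (by simpa using hz.ne')
      simp only [one_div]
      convert! this using 1
      simp
      field_simp
    convert! (hEd z hz).mul h1.exp using 1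
    ring
  have hanti : AntitoneOn F (Set.Ici 1) := by
    apply antitoneOn_of_deriv_nonpos (convex_Ici 1)
    · exact fun z hz => (hFd z (lt_of_lt_of_le one_pos hz)).continuousAt.continuousWithinAt
    · intro z hz
      rw [interior_Ici] at hz
      exact (hFd z (one_pos.trans hz)).differentiableAt.differentiableWithinAt
    · intro z hz
      rw [interior_Ici] at hz
      have hz0 : 0 < z := one_pos.trans hz
      rw [(hFd z hz0).deriv]
      refine mul_nonpos_of_nonpos_of_nonneg ?_ (Real.exp_pos _).le
      have h1 := neg_le_of_abs_le (abs_real_inner_le_norm (besselAux z) (besselMoment 0 z))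
      have h2 := two_mul_le_add_sq ‖besselAux z‖ ‖besselMoment 0 z‖
      have h3 : -(inner ℝ (besselAux z) (besselMoment 0 z)) / (2 * z) - E z / (4 * z ^ 2)
          = (-2 * inner ℝ (besselAux z) (besselMoment 0 z)
            - (‖besselMoment 0 z‖ ^ 2 + ‖besselAux z‖ ^ 2)) / (4 * z) := by
        rw [hE]; field_simp; ring
      rw [h3]
      exact div_nonpos_of_nonpos_of_nonneg (by nlinarith) (by positivity)
  have hE0 : ∀ z : ℝ, 0 ≤ z → 0 ≤ E z := fun z hz => by simp only [hE]; positivity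
  refine ⟨√(F 1) + 1, by positivity, fun z hz => ?_⟩
  have hz0 : 0 < z := by linarith
  have h1 : F z ≤ F 1 := hanti (Set.self_mem_Ici) hz hz
  have h2 : E z ≤ F 1 := by
    refine le_trans ?_ h1
    exact le_mul_of_one_le_right (hE0 z hz0.le) (Real.one_le_exp (by positivity))
  have h3 : ∀ x : ℝ, 0 ≤ x → z * x ^ 2 ≤ F 1 → x ≤ (√(F 1) + 1) / √z := by
    intro x hx hxF
    rw [le_div_iff₀ (Real.sqrt_pos.2 hz0)]
    have : x * √z ≤ √(F 1) := by
      apply Real.le_sqrt_of_sq_le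
      rw [mul_pow, Real.sq_sqrt hz0.le]
      linarith
    linarith
  constructor
  · refine h3 _ (norm_nonneg _) (le_trans ?_ h2)
    simp only [hE]
    gcongr
    linarith [sq_nonneg ‖besselAux z‖]
  · refine h3 _ (norm_nonneg _) (le_trans ?_ h2)
    simp only [hE]
    gcongr
    linarith [sq_nonneg ‖besselMoment 0 z‖]

/-- The amplitudes in `B(z) = e^{iz} G₁(z) + e^{-iz} G₋₁(z)`, obtained by variation of constants. -/
noncomputable def besselAmp (σ z : ℝ) : ℂ :=
  Complex.exp (Complex.I * (-(σ * z) : ℝ)) * (besselMoment 0 z - Complex.I * σ * besselAux z) / 2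

/-- The derivative of `besselAmp σ` on `(0, ∞)`, when `σ = ±1`. -/
noncomputable def besselAmp' (σ z : ℝ) : ℂ :=
  Complex.exp (Complex.I * (-(σ * z) : ℝ)) *
    (-(besselMoment 0 z - Complex.I * σ * besselAux z) / (2 * z)
      + Complex.I * σ * besselMoment 0 z / (4 * z ^ 2)) / 2

theorem besselMoment_zero_eq_besselAmp (z : ℝ) :
    besselMoment 0 z = Complex.exp (Complex.I * z) * besselAmp 1 z
      + Complex.exp (Complex.I * (-z : ℝ)) * besselAmp (-1) z := by
  have h : Complex.exp (Complex.I * z) * Complex.exp (Complex.I * (-z : ℝ)) = 1 := by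
    rw [← Complex.exp_add]; simp
  simp only [besselAmp, one_mul, neg_mul, neg_neg]
  push_cast at h ⊢
  linear_combination (-besselMoment 0 z) * h

theorem hasDerivAt_besselAmp {σ z : ℝ} (hσ : σ ^ 2 = 1) (hz : 0 < z) :
    HasDerivAt (besselAmp σ) (besselAmp' σ z) z := by
  have hz' : (z : ℂ) ≠ 0 := by exact_mod_cast hz.ne'
  have hσ' : (σ : ℂ) ^ 2 = 1 := by exact_mod_cast hσ
  have h0 : HasDerivAt (fun z : ℝ => -(σ * z)) (-σ) z := by
    simpa using! ((hasDerivAt_id z).const_mul σ).neg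
  have h1 := (h0.ofReal_comp.const_mul Complex.I).cexp
  have h2 := (hasDerivAt_besselMoment_zero z).sub
    ((hasDerivAt_besselAux hz).const_mul (Complex.I * σ))
  convert! (h1.mul h2).div_const 2 using 1
  rw [besselAmp', mul_assoc (Complex.exp _) (Complex.I * _), ← mul_add]
  congr 2
  push_cast [Pi.sub_apply]
  have hI := Complex.I_sq
  field_simp
  linear_combination (-8 * σ ^ 2 * besselAux z * z ^ 2 : ℂ) * hI + 8 * besselAux z * z ^ 2 * hσ'

theorem continuousOn_besselAmp' (σ : ℝ) : ContinuousOn (besselAmp' σ) (Set.Ioi 0) := by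
  have h0 := continuous_besselMoment 0
  have h1 := continuous_besselMoment 1
  unfold besselAmp' besselAux
  have h2 : ∀ z ∈ Set.Ioi (0 : ℝ), (z : ℂ) ≠ 0 := fun z hz => by
    exact_mod_cast (ne_of_gt hz)
  refine ContinuousOn.div_const (ContinuousOn.mul (by fun_prop) (ContinuousOn.add
    (ContinuousOn.div (ContinuousOn.neg (ContinuousOn.sub (by fun_prop) (ContinuousOn.mul
      (by fun_prop) (ContinuousOn.add (by fun_prop) (ContinuousOn.div (by fun_prop)
        (by fun_prop) fun z hz => ?_))))) (by fun_prop) fun z hz => ?_)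
    (ContinuousOn.div (by fun_prop) (by fun_prop) fun z hz => ?_))) 2
  all_goals simpa using h2 z hz

/-- The amplitudes decay like `z^{-1/2}` and their derivatives gain a factor `1/z`: variation of
constants removes the rotation part of Bessel's equation. -/
theorem exists_norm_besselAmp_le : ∃ C : ℝ, 0 < C ∧ ∀ σ : ℝ, σ ^ 2 = 1 → ∀ z : ℝ, 1 ≤ z →
    ‖besselAmp σ z‖ ≤ C / √z ∧ ‖besselAmp' σ z‖ ≤ C / √z / z := by
  obtain ⟨C, hC, h⟩ := exists_norm_besselMoment_le
  refine ⟨C, hC, fun σ hσ z hz => ?_⟩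
  obtain ⟨h1, h2⟩ := h z hz
  have hσ' : ‖(σ : ℂ)‖ = 1 := by
    rw [Complex.norm_real, Real.norm_eq_abs, ← sq_eq_sq₀ (abs_nonneg _) zero_le_one, sq_abs, hσ,
      one_pow]
  have hexp : ‖Complex.exp (Complex.I * (-(σ * z) : ℝ))‖ = 1 := by
    rw [mul_comm]; exact Complex.norm_exp_ofReal_mul_I _
  have h3 : ‖besselMoment 0 z - Complex.I * σ * besselAux z‖ ≤ 2 * (C / √z) := by
    refine (norm_sub_le _ _).trans ?_
    rw [norm_mul, norm_mul, Complex.norm_I, hσ']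
    linarith
  have hz0 : 0 < z := by linarith
  have hzn : ‖(z : ℂ)‖ = z := by rw [Complex.norm_real, Real.norm_of_nonneg hz0.le]
  constructor
  · rw [besselAmp, norm_div, norm_mul, hexp, Complex.norm_ofNat]
    linarith
  · rw [besselAmp', norm_div, norm_mul, hexp, Complex.norm_ofNat, one_mul,
      div_le_iff₀ two_pos]
    refine (norm_add_le _ _).trans ?_
    rw [norm_div, norm_div, norm_neg, norm_mul, norm_mul, norm_mul, norm_mul, norm_pow, hzn, hσ',
      Complex.norm_I, Complex.norm_ofNat, Complex.norm_ofNat, one_mul, one_mul]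
    have e1 : ‖besselMoment 0 z - Complex.I * σ * besselAux z‖ / (2 * z) ≤ C / √z / z := by
      rw [div_le_div_iff₀ (by positivity) hz0]
      nlinarith
    have e2 : ‖besselMoment 0 z‖ / (4 * z ^ 2) ≤ C / √z / z := by
      apply div_le_div₀ (by positivity) h1 hz0
      nlinarith
    linarith

/-! ### Radial oscillatory integrals -/

/-- The decay rate `λ^{3/4} |τ|^{-1/2}` in dimension one; the rate in dimension `d` is its `d`-th
power. -/
noncomputable def dispersiveRate (lam τ : ℝ) : ℝ := lam ^ (3 / 4 : ℝ) * |τ| ^ (-1 / 2 : ℝ)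

theorem dispersiveRate_pos {lam τ : ℝ} (hlam : 0 < lam) (hτ : τ ≠ 0) :
    0 < dispersiveRate lam τ := by
  have := abs_pos.2 hτ
  unfold dispersiveRate
  positivity

theorem dispersiveRate_sq {lam τ : ℝ} (hlam : 0 < lam) (hτ : τ ≠ 0) :
    dispersiveRate lam τ ^ 2 = √lam ^ 3 / |τ| := by
  have h := abs_pos.2 hτ
  rw [dispersiveRate, mul_pow, ← Real.rpow_natCast, ← Real.rpow_natCast (|τ| ^ _),
    ← Real.rpow_mul hlam.le, ← Real.rpow_mul h.le, Real.sqrt_eq_rpow, ← Real.rpow_natCast,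
    ← Real.rpow_mul hlam.le]
  norm_num
  rw [Real.rpow_neg_one]
  rfl

theorem dispersiveRate_neg (lam τ : ℝ) : dispersiveRate lam (-τ) = dispersiveRate lam τ := by
  rw [dispersiveRate, dispersiveRate, abs_neg]

theorem dispersiveRate_pow {lam : ℝ} (hlam : 0 < lam) (τ : ℝ) (d : ℕ) :
    dispersiveRate lam τ ^ d = lam ^ (3 * (d : ℝ) / 4) * |τ| ^ (-(d : ℝ) / 2) := by
  rw [dispersiveRate, mul_pow, ← Real.rpow_natCast, ← Real.rpow_natCast (|τ| ^ _),
    ← Real.rpow_mul hlam.le, ← Real.rpow_mul (abs_nonneg τ)]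
  congr 2 <;> ring

theorem eight_div_sqrt_le {lam τ : ℝ} (hlam : 0 < lam) (hτ : τ ≠ 0) :
    8 / √(|τ| * (1 / 200 / √lam ^ 3)) ≤ 120 * dispersiveRate lam τ := by
  have h := abs_pos.2 hτ
  have hs := Real.sqrt_pos.2 hlam
  have hP := dispersiveRate_pos hlam hτ
  have hq : 0 < √(|τ| * (1 / 200 / √lam ^ 3)) := Real.sqrt_pos.2 (by positivity)
  rw [← sq_le_sq₀ (by positivity) (by positivity), div_pow, Real.sq_sqrt (by positivity), mul_pow,
    dispersiveRate_sq hlam hτ]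
  have e : 8 ^ 2 / (|τ| * (1 / 200 / √lam ^ 3)) = 12800 * (√lam ^ 3 / |τ|) := by
    field_simp; norm_num
  rw [e]
  have : 0 ≤ √lam ^ 3 / |τ| := by positivity
  linarith

/-- A `C¹` profile `β` with `β 2 = 0` whose values and slopes are at most `B`. -/
structure ProfileBound (β β' : ℝ → ℝ) (B : ℝ) : Prop where
  hasDerivAt : ∀ s, HasDerivAt β (β' s) s
  continuous_deriv : Continuous β'
  abs_le : ∀ s, |β s| ≤ B
  abs_deriv_le : ∀ s, |β' s| ≤ B
  eq_zero : β 2 = 0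

namespace ProfileBound

variable {β β' : ℝ → ℝ} {B : ℝ}

theorem nonneg (h : ProfileBound β β' B) : 0 ≤ B := (abs_nonneg _).trans (h.abs_le 0)

theorem continuous (h : ProfileBound β β' B) : Continuous β :=
  continuous_iff_continuousAt.2 fun s => (h.hasDerivAt s).continuousAt

theorem hasDerivAt_comp_div (h : ProfileBound β β' B) (lam r : ℝ) :
    HasDerivAt (fun r => β (r / lam)) (β' (r / lam) / lam) r := by
  have := (h.hasDerivAt (r / lam)).comp r ((hasDerivAt_id r).div_const lam)
  convert! this using 1
  ring

/-- The radial integral over a dyadic shell, without Jacobian. -/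
theorem norm_integral_le (h : ProfileBound β β' B) {lam τ : ℝ} (hlam : 2 ≤ lam) (hτ : τ ≠ 0)
    (y : ℝ) :
    ‖∫ r in lam / 2..2 * lam, Complex.exp (Complex.I * radialPhase y τ r) * (β (r / lam) : ℂ)‖
      ≤ 180 * B * dispersiveRate lam τ := by
  have hl : 0 < lam := by linarith
  have := norm_integral_mul_le_of_forall_norm_integral_le (a := lam / 2) (b := 2 * lam)
    (e := fun r => Complex.exp (Complex.I * radialPhase y τ r)) (ψ := fun r => (β (r / lam) : ℂ))
    (ψ' := fun r => ((β' (r / lam) / lam : ℝ) : ℂ)) (D := B / lam) (by linarith)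
    (continuous_cexp_radialPhase y τ)
    (fun x hx => (norm_integral_cexp_radialPhase_le (y := y) hlam hτ hx).trans
      (eight_div_sqrt_le hl hτ))
    (fun r _ => (h.hasDerivAt_comp_div lam r).ofReal_comp)
    (by have := h.continuous_deriv; apply Continuous.continuousOn; fun_prop)
    (by rw [mul_div_cancel_right₀ _ hl.ne', h.eq_zero, Complex.ofReal_zero])
    (fun r _ => by
      rw [Complex.norm_real, Real.norm_eq_abs, abs_div, abs_of_pos hl]
      exact div_le_div_of_nonneg_right (h.abs_deriv_le _) hl.le)
  refine this.trans (le_of_eq ?_)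
  field_simp
  ring

theorem hasDerivAt_mul_comp_div (h : ProfileBound β β' B) (lam r : ℝ) :
    HasDerivAt (fun r => r * β (r / lam)) (β (r / lam) + r * (β' (r / lam) / lam)) r := by
  convert! (hasDerivAt_id r).mul (h.hasDerivAt_comp_div lam r) using 1
  simp

theorem abs_deriv_mul_comp_div_le (h : ProfileBound β β' B) {lam r : ℝ} (hlam : 0 < lam)
    (hr0 : 0 ≤ r) (hr : r ≤ 2 * lam) : |β (r / lam) + r * (β' (r / lam) / lam)| ≤ 3 * B := by
  refine (abs_add_le _ _).trans ?_
  have e : r * (β' (r / lam) / lam) = (r / lam) * β' (r / lam) := by ring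
  have h1 : r / lam ≤ 2 := by rw [div_le_iff₀ hlam]; exact hr
  have h0 : 0 ≤ r / lam := by positivity
  rw [e, abs_mul, abs_of_nonneg h0]
  have h2 := mul_le_mul h1 (h.abs_deriv_le (r / lam)) (abs_nonneg _) (by norm_num)
  linarith [h.abs_le (r / lam)]

/-- Far from the light cone the radial integral is as small as required before integrating in the
angle. -/
theorem norm_integral_mul_le_of_abs_le (h : ProfileBound β β' B) {lam τ y : ℝ} (hlam : 2 ≤ lam)
    (hτ : τ ≠ 0) (hy : |y| ≤ |τ| * (1 / 10 / √lam)) :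
    ‖∫ r in lam / 2..2 * lam, Complex.exp (Complex.I * radialPhase y τ r)
      * ((r * β (r / lam) : ℝ) : ℂ)‖ ≤ 150 * B * dispersiveRate lam τ ^ 2 := by
  have hl : 0 < lam := by linarith
  have hs := Real.sqrt_pos.2 hl
  have hss := Real.sq_sqrt hl.le
  have hτ' := abs_pos.2 hτ
  have := norm_integral_mul_le_of_forall_norm_integral_le (a := lam / 2) (b := 2 * lam)
    (e := fun r => Complex.exp (Complex.I * radialPhase y τ r))
    (ψ := fun r => ((r * β (r / lam) : ℝ) : ℂ))
    (ψ' := fun r => ((β (r / lam) + r * (β' (r / lam) / lam) : ℝ) : ℂ)) (D := 3 * B) (by linarith)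
    (continuous_cexp_radialPhase y τ)
    (fun x hx => norm_integral_cexp_radialPhase_le_of_abs_le hlam hτ hy hx)
    (fun r _ => (h.hasDerivAt_mul_comp_div lam r).ofReal_comp)
    (by
      have := h.continuous_deriv
      have := h.continuous
      apply Continuous.continuousOn; fun_prop)
    (by rw [mul_div_cancel_right₀ _ hl.ne', h.eq_zero, mul_zero, Complex.ofReal_zero])
    (fun r hr => by
      rw [Complex.norm_real, Real.norm_eq_abs]
      exact h.abs_deriv_mul_comp_div_le hl (by linarith [hr.1]) hr.2)
  refine this.trans (le_of_eq ?_)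
  rw [dispersiveRate_sq hl hτ]
  field_simp
  rw [show √lam ^ 2 = lam from hss]
  ring

/-- Near the light cone and beyond it, `ρ / |τ|` is at least of order `λ^{-1/2}`, so that the decay
`(ρ λ)^{-1/2}` of the amplitude supplies one factor of the rate, and the second derivative test
the other. -/
theorem norm_integral_mul_besselAmp_le (h : ProfileBound β β' B) {C lam τ ρ σ : ℝ}
    (hlam : 2 ≤ lam) (hτ : τ ≠ 0) (hσ : σ ^ 2 = 1) (hρ : |τ| * (1 / 10 / √lam) ≤ ρ)
    (hρ' : 2 ≤ ρ * lam)
    (hC : ∀ z : ℝ, 1 ≤ z → ‖besselAmp σ z‖ ≤ C / √z ∧ ‖besselAmp' σ z‖ ≤ C / √z / z) :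
    ‖∫ r in lam / 2..2 * lam, Complex.exp (Complex.I * radialPhase (σ * ρ) τ r)
      * (((r * β (r / lam) : ℝ) : ℂ) * besselAmp σ (ρ * r))‖
      ≤ 4320 * B * C * dispersiveRate lam τ ^ 2 := by
  have hl : 0 < lam := by linarith
  have hs := Real.sqrt_pos.2 hl
  have hss := Real.sq_sqrt hl.le
  have hτ' := abs_pos.2 hτ
  have hρ0 : 0 < ρ := lt_of_lt_of_le (by positivity) hρ
  have hB := h.nonneg
  have hP := dispersiveRate_pos hl hτ
  have hC0 : 0 ≤ C := by
    have := (norm_nonneg _).trans (hC 1 le_rfl).1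
    simpa using this
  have hz : ∀ r ∈ Set.Icc (lam / 2) (2 * lam), 1 ≤ ρ * r := fun r hr => by
    have := mul_le_mul_of_nonneg_left hr.1 hρ0.le
    linarith
  have hr0 : ∀ r ∈ Set.Icc (lam / 2) (2 * lam), 0 < r := fun r hr => by linarith [hr.1]
  have hdG : ∀ r ∈ Set.Icc (lam / 2) (2 * lam),
      HasDerivAt (fun r => besselAmp σ (ρ * r)) (ρ * besselAmp' σ (ρ * r)) r := by
    intro r hr
    have h1 : HasDerivAt (fun r => ρ * r) ρ r := by simpa using (hasDerivAt_id r).const_mul ρ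
    have h2 := (hasDerivAt_besselAmp hσ (by linarith [hz r hr] : 0 < ρ * r)).scomp r h1
    simpa using! h2
  have hcG : ContinuousOn (fun r => besselAmp' σ (ρ * r)) (Set.Icc (lam / 2) (2 * lam)) :=
    (continuousOn_besselAmp' σ).comp (by fun_prop) fun r hr => mul_pos hρ0 (hr0 r hr)
  have := norm_integral_mul_le_of_forall_norm_integral_le (a := lam / 2) (b := 2 * lam)
    (e := fun r => Complex.exp (Complex.I * radialPhase (σ * ρ) τ r))
    (ψ := fun r => ((r * β (r / lam) : ℝ) : ℂ) * besselAmp σ (ρ * r))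
    (ψ' := fun r => ((β (r / lam) + r * (β' (r / lam) / lam) : ℝ) : ℂ) * besselAmp σ (ρ * r)
      + ((r * β (r / lam) : ℝ) : ℂ) * (ρ * besselAmp' σ (ρ * r)))
    (D := 6 * B * C / √(ρ * lam)) (by linarith)
    (continuous_cexp_radialPhase (σ * ρ) τ)
    (fun x hx => (norm_integral_cexp_radialPhase_le (y := σ * ρ) hlam hτ hx).trans
      (eight_div_sqrt_le hl hτ))
    (fun r hr => (h.hasDerivAt_mul_comp_div lam r).ofReal_comp.mul (hdG r hr))
    (by
      have h1 := h.continuous_deriv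
      have h2 := h.continuous
      have h3 : ContinuousOn (fun r => besselAmp σ (ρ * r)) (Set.Icc (lam / 2) (2 * lam)) :=
        fun r hr => (hdG r hr).continuousAt.continuousWithinAt
      refine ContinuousOn.add (ContinuousOn.mul (Continuous.continuousOn (by fun_prop)) h3)
        (ContinuousOn.mul (Continuous.continuousOn (by fun_prop)) (continuousOn_const.mul hcG)))
    (by rw [mul_div_cancel_right₀ _ hl.ne', h.eq_zero, mul_zero, Complex.ofReal_zero, zero_mul])
    (fun r hr => by
      obtain ⟨g1, g2⟩ := hC _ (hz r hr)
      have hr0 := hr0 r hr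
      have hρr : 0 < ρ * r := mul_pos hρ0 hr0
      refine (norm_add_le _ _).trans ?_
      rw [norm_mul, norm_mul, norm_mul, Complex.norm_real, Complex.norm_real, Complex.norm_real,
        Real.norm_eq_abs, Real.norm_eq_abs, Real.norm_of_nonneg hρ0.le, abs_mul, abs_of_pos hr0]
      have e1 : |β (r / lam) + r * (β' (r / lam) / lam)| * ‖besselAmp σ (ρ * r)‖
          ≤ 3 * B * (C / √(ρ * r)) :=
        mul_le_mul (h.abs_deriv_mul_comp_div_le hl hr0.le hr.2) g1 (norm_nonneg _) (by positivity)
      have e2 : r * |β (r / lam)| * (ρ * ‖besselAmp' σ (ρ * r)‖)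
          ≤ r * B * (ρ * (C / √(ρ * r) / (ρ * r))) := by
        gcongr
        exact h.abs_le _
      have e3 : r * B * (ρ * (C / √(ρ * r) / (ρ * r))) = B * (C / √(ρ * r)) := by
        field_simp
      have e4 : 1 / √(ρ * r) ≤ (3 / 2) / √(ρ * lam) := by
        rw [div_le_div_iff₀ (Real.sqrt_pos.2 hρr) (Real.sqrt_pos.2 (by positivity)), one_mul]
        have : √(ρ * lam) ≤ √((3 / 2) ^ 2 * (ρ * r)) := by
          apply Real.sqrt_le_sqrt
          have := mul_le_mul_of_nonneg_left hr.1 hρ0.le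
          linarith
        rwa [Real.sqrt_mul (x := (3 / 2) ^ 2) (by positivity), Real.sqrt_sq (by norm_num)] at this
      have e5 : 4 * B * C * (1 / √(ρ * r)) ≤ 4 * B * C * ((3 / 2) / √(ρ * lam)) := by gcongr
      calc _ ≤ 3 * B * (C / √(ρ * r)) + B * (C / √(ρ * r)) := by linarith
        _ = 4 * B * C * (1 / √(ρ * r)) := by ring
        _ ≤ _ := e5
        _ = _ := by ring)
  refine this.trans ?_
  have hq : 0 < √(ρ * lam) := Real.sqrt_pos.2 (by positivity)
  -- `λ / √(ρ λ) ≤ 4 λ^{3/4} |τ|^{-1/2}`, because `ρ` is bounded below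
  have key : lam / √(ρ * lam) ≤ 4 * dispersiveRate lam τ := by
    rw [← sq_le_sq₀ (by positivity) (by positivity), div_pow, Real.sq_sqrt (by positivity),
      mul_pow, dispersiveRate_sq hl hτ]
    have e1 : lam ^ 2 / (ρ * lam) = lam / ρ := by field_simp
    have e2 : lam / ρ ≤ lam / (|τ| * (1 / 10 / √lam)) := by gcongr
    have e3 : lam / (|τ| * (1 / 10 / √lam)) = 10 * (√lam ^ 3 / |τ|) := by
      field_simp
      rw [show √lam ^ 2 = lam from hss]
    have e4 : 0 ≤ √lam ^ 3 / |τ| := by positivity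
    rw [e1]
    linarith
  calc 120 * dispersiveRate lam τ * (6 * B * C / √(ρ * lam)) * (2 * lam - lam / 2)
      = 1080 * B * C * dispersiveRate lam τ * (lam / √(ρ * lam)) := by ring
    _ ≤ 1080 * B * C * dispersiveRate lam τ * (4 * dispersiveRate lam τ) := by gcongr
    _ = _ := by ring

/-- The radial integral over a dyadic shell in the plane, where the angular integration has
produced a Bessel function. -/
theorem exists_norm_integral_mul_besselMoment_le (h : ProfileBound β β' B) :
    ∃ C : ℝ, ∀ lam τ ρ : ℝ, 2 ≤ lam → τ ≠ 0 → 0 ≤ ρ →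
      ‖∫ r in lam / 2..2 * lam, Complex.exp (Complex.I * radialPhase 0 τ r)
        * ((r * β (r / lam) : ℝ) : ℂ) * besselMoment 0 (ρ * r)‖
        ≤ C * dispersiveRate lam τ ^ 2 := by
  obtain ⟨C, hC, hG⟩ := exists_norm_besselAmp_le
  have hB := h.nonneg
  have hcβ := h.continuous
  have hπ := Real.pi_pos
  refine ⟨max (300 * Real.pi * B) (max (8640 * B * C) (120 * Real.pi * B)),
    fun lam τ ρ hlam hτ hρ0 => ?_⟩
  have hl : 0 < lam := by linarith
  have hs := Real.sqrt_pos.2 hl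
  have hss := Real.sq_sqrt hl.le
  have hτ' := abs_pos.2 hτ
  have hP2 : 0 ≤ dispersiveRate lam τ ^ 2 := sq_nonneg _
  have hcos := Real.continuous_cos
  rcases le_total ρ (|τ| * (1 / 10 / √lam)) with hρ | hρ
  -- no stationary point for any angle: integrate in `r` first
  · refine le_trans ?_ (mul_le_mul_of_nonneg_right (le_max_left _ _) hP2)
    have e1 : ∫ r in lam / 2..2 * lam, Complex.exp (Complex.I * radialPhase 0 τ r)
        * ((r * β (r / lam) : ℝ) : ℂ) * besselMoment 0 (ρ * r)
        = ∫ θ in -Real.pi..Real.pi, ∫ r in lam / 2..2 * lam,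
          Complex.exp (Complex.I * radialPhase (ρ * Real.cos θ) τ r)
            * ((r * β (r / lam) : ℝ) : ℂ) := by
      rw [intervalIntegral_intervalIntegral_swap]
      · congr 1
        funext r
        rw [besselMoment, ← intervalIntegral.integral_const_mul]
        congr 1
        funext θ
        rw [pow_zero, one_mul, mul_right_comm, ← Complex.exp_add]
        congr 2
        simp only [radialPhase]
        push_cast
        ring
      · have h1 := continuous_waveFreq
        refine IntegrableOn.mono_set (ContinuousOn.integrableOn_compact
          (isCompact_uIcc.prod isCompact_uIcc) (Continuous.continuousOn ?_))
          (Set.prod_mono Set.uIoc_subset_uIcc Set.uIoc_subset_uIcc)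
        simp only [Function.uncurry_def, radialPhase]
        fun_prop
    rw [e1]
    refine (intervalIntegral.norm_integral_le_of_norm_le_const
      (C := 150 * B * dispersiveRate lam τ ^ 2) fun θ _ => ?_).trans (le_of_eq ?_)
    · refine h.norm_integral_mul_le_of_abs_le hlam hτ (le_trans ?_ hρ)
      rw [abs_mul, abs_of_nonneg hρ0]
      exact mul_le_of_le_one_right hρ0 (Real.abs_cos_le_one θ)
    · rw [abs_of_nonneg (by linarith)]; ring
  rcases le_total 2 (ρ * lam) with hρl | hρl
  -- the argument of the Bessel function is at least `1` on the shell: use its amplitudes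
  · refine le_trans ?_ (mul_le_mul_of_nonneg_right
      ((le_max_left _ _).trans (le_max_right _ _)) hP2)
    have hρ1 : 0 < ρ := lt_of_lt_of_le (by positivity) hρ
    have h1 := h.norm_integral_mul_besselAmp_le (σ := 1) hlam hτ (by norm_num) hρ hρl
      (hG 1 (by norm_num))
    have h2 := h.norm_integral_mul_besselAmp_le (σ := -1) hlam hτ (by norm_num) hρ hρl
      (hG (-1) (by norm_num))
    have hint : ∀ σ : ℝ, σ ^ 2 = 1 → IntervalIntegrable (fun r : ℝ =>
        Complex.exp (Complex.I * radialPhase (σ * ρ) τ r)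
          * (((r * β (r / lam) : ℝ) : ℂ) * besselAmp σ (ρ * r))) volume (lam / 2) (2 * lam) := by
      intro σ hσ
      apply ContinuousOn.intervalIntegrable_of_Icc (by linarith)
      refine (continuous_cexp_radialPhase _ _).continuousOn.mul
        (ContinuousOn.mul (Continuous.continuousOn (by fun_prop)) fun r hr => ?_)
      have hr0 : 0 < ρ * r := mul_pos hρ1 (by linarith [hr.1])
      exact ((hasDerivAt_besselAmp hσ hr0).continuousAt.comp (f := fun r => ρ * r)
        (by fun_prop)).continuousWithinAt
    have e1 : ∫ r in lam / 2..2 * lam, Complex.exp (Complex.I * radialPhase 0 τ r)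
        * ((r * β (r / lam) : ℝ) : ℂ) * besselMoment 0 (ρ * r)
        = (∫ r in lam / 2..2 * lam, Complex.exp (Complex.I * radialPhase (1 * ρ) τ r)
          * (((r * β (r / lam) : ℝ) : ℂ) * besselAmp 1 (ρ * r)))
        + ∫ r in lam / 2..2 * lam, Complex.exp (Complex.I * radialPhase (-1 * ρ) τ r)
          * (((r * β (r / lam) : ℝ) : ℂ) * besselAmp (-1) (ρ * r)) := by
      rw [← intervalIntegral.integral_add (hint 1 (by norm_num)) (hint (-1) (by norm_num))]
      congr 1
      funext r
      have e2 : ∀ y : ℝ, Complex.exp (Complex.I * radialPhase y τ r)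
          = Complex.exp (Complex.I * radialPhase 0 τ r)
            * Complex.exp (Complex.I * (y * r : ℝ)) := by
        intro y
        rw [← Complex.exp_add]
        congr 1
        simp only [radialPhase]
        push_cast
        ring
      rw [besselMoment_zero_eq_besselAmp, e2 (1 * ρ), e2 (-1 * ρ)]
      simp only [one_mul, neg_mul]
      ring
    rw [e1]
    refine (norm_add_le _ _).trans ?_
    linarith
  · refine le_trans ?_ (mul_le_mul_of_nonneg_right
      ((le_max_right _ _).trans (le_max_right _ _)) hP2)
    -- here `|τ| √λ ≤ 20`, and the size of the domain is enough
    have hτl : |τ| ≤ 20 / √lam := by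
      have e1 : |τ| * (1 / 10 / √lam) * lam ≤ 2 :=
        (mul_le_mul_of_nonneg_right hρ hl.le).trans hρl
      have e2 : |τ| * (1 / 10 / √lam) * lam = |τ| * √lam / 10 := by
        nth_rewrite 2 [← hss]
        field_simp
      rw [le_div_iff₀ hs]
      linarith
    have hbig : lam ^ 2 ≤ 20 * dispersiveRate lam τ ^ 2 := by
      rw [dispersiveRate_sq hl hτ, mul_div_assoc', le_div_iff₀ hτ']
      calc lam ^ 2 * |τ| ≤ lam ^ 2 * (20 / √lam) := by gcongr
        _ = 20 * √lam ^ 3 := by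
          nth_rewrite 1 [← hss]
          field_simp
    have hJ : ∀ z, ‖besselMoment 0 z‖ ≤ 2 * Real.pi := by
      intro z
      refine (intervalIntegral.norm_integral_le_of_norm_le_const (C := 1)
        fun θ _ => ?_).trans (le_of_eq ?_)
      · rw [pow_zero, one_mul, mul_comm]
        exact (Complex.norm_exp_ofReal_mul_I _).le
      · rw [abs_of_nonneg (by linarith)]; ring
    refine (intervalIntegral.norm_integral_le_of_norm_le_const
      (C := 2 * lam * B * (2 * Real.pi)) fun r hr => ?_).trans ?_
    · rw [Set.uIoc_of_le (by linarith)] at hr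
      rw [norm_mul, norm_mul, norm_cexp_radialPhase, one_mul, Complex.norm_real, Real.norm_eq_abs,
        abs_mul, abs_of_pos (by linarith [hr.1])]
      gcongr
      · exact hr.2
      · exact h.abs_le _
      · exact hJ _
    · rw [abs_of_nonneg (by linarith)]
      calc 2 * lam * B * (2 * Real.pi) * (2 * lam - lam / 2) = 6 * Real.pi * B * lam ^ 2 := by ring
        _ ≤ 6 * Real.pi * B * (20 * dispersiveRate lam τ ^ 2) := by gcongr
        _ = _ := by ring

end ProfileBound

/-! ### The convolution kernel -/

namespace IsCutoff

variable {χ : ℝ → ℝ}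

theorem eq_zero_of_two_le (hχ : IsCutoff χ) {s : ℝ} (hs : 2 ≤ |s|) : χ s = 0 := by
  by_contra h
  have h1 := hχ.tsupport_subset (subset_tsupport χ h)
  exact absurd (abs_lt.2 ⟨h1.1, h1.2⟩) (not_lt.2 hs)

/-- The Littlewood-Paley profile vanishes outside the shell `1/2 ≤ s ≤ 2`. -/
theorem profile_eq_zero (hχ : IsCutoff χ) {s : ℝ} (h0 : 0 ≤ s) (hs : s ≤ 1 / 2 ∨ 2 ≤ s) :
    χ s - χ (2 * s) = 0 := by
  rcases hs with hs | hs
  · rw [hχ.eq_one s (by rw [abs_of_nonneg h0]; linarith),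
      hχ.eq_one (2 * s) (by rw [abs_of_nonneg (by linarith)]; linarith), sub_self]
  · rw [hχ.eq_zero_of_two_le (by rw [abs_of_nonneg h0]; exact hs),
      hχ.eq_zero_of_two_le (by rw [abs_of_nonneg (by linarith)]; linarith), sub_self]

theorem exists_profileBound (hχ : IsCutoff χ) :
    ∃ β' B, ProfileBound (fun s => χ s - χ (2 * s)) β' B := by
  have hs : HasCompactSupport χ := by
    refine HasCompactSupport.intro (isCompact_Icc (a := -2) (b := 2)) fun x hx => ?_
    exact hχ.eq_zero_of_two_le (by
      by_contra h
      exact hx ⟨(abs_lt.1 (not_le.1 h)).1.le, (abs_lt.1 (not_le.1 h)).2.le⟩)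
  obtain ⟨B₁, h1⟩ := hs.exists_bound_of_continuous hχ.smooth.continuous
  have hcd : Continuous (deriv χ) := hχ.smooth.continuous_deriv (by norm_num)
  obtain ⟨B₂, h2⟩ := hs.deriv.exists_bound_of_continuous hcd
  have hd : ∀ s, HasDerivAt χ (deriv χ s) s := fun s =>
    ((hχ.smooth.differentiable (by norm_num)) s).hasDerivAt
  refine ⟨fun s => deriv χ s - deriv χ (2 * s) * 2, max (2 * B₁) (3 * B₂), fun s => ?_, ?_,
    fun s => ?_, fun s => ?_, ?_⟩
  · have h3 : HasDerivAt (fun s : ℝ => 2 * s) 2 s := by simpa using (hasDerivAt_id s).const_mul 2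
    exact (hd s).sub ((hd (2 * s)).comp s h3)
  · fun_prop
  · refine le_trans ((abs_sub _ _).trans ?_) (le_max_left _ _)
    have e1 := h1 s
    have e2 := h1 (2 * s)
    rw [Real.norm_eq_abs] at e1 e2
    linarith
  · refine le_trans ((abs_sub _ _).trans ?_) (le_max_right _ _)
    have e1 := h2 s
    have e2 := h2 (2 * s)
    rw [Real.norm_eq_abs] at e1 e2
    rw [abs_mul, abs_two]
    linarith
  · exact hχ.profile_eq_zero (by norm_num) (Or.inr le_rfl)

end IsCutoff

/-- The symbol of the localized free wave, in the angular frequency. -/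
noncomputable def waveSymbol (χ : ℝ → ℝ) (d : ℕ) (lam τ : ℝ) (ξ : EuclideanSpace ℝ (Fin d)) : ℂ :=
  propagatorSymbol d τ ξ * (projectionSymbol χ lam ξ : ℂ)

theorem norm_propagatorSymbol (d : ℕ) (τ : ℝ) (ξ : EuclideanSpace ℝ (Fin d)) :
    ‖propagatorSymbol d τ ξ‖ = 1 := by
  have : -(Complex.I * τ * dispersionSymbol d ξ)
      = ((-(τ * dispersionSymbol d ξ) : ℝ) : ℂ) * Complex.I := by push_cast; ring
  rw [propagatorSymbol, this, Complex.norm_exp_ofReal_mul_I]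

theorem waveSymbol_eq_zero {χ : ℝ → ℝ} (hχ : IsCutoff χ) {d : ℕ} {lam : ℝ} (hlam : 0 < lam) (τ : ℝ)
    {ξ : EuclideanSpace ℝ (Fin d)} (hξ : ‖ξ‖ ≤ lam / 2 ∨ 2 * lam ≤ ‖ξ‖) :
    waveSymbol χ d lam τ ξ = 0 := by
  rw [waveSymbol, projectionSymbol, hχ.profile_eq_zero (by positivity), Complex.ofReal_zero,
    mul_zero]
  rcases hξ with h | h
  · left; rw [div_le_iff₀ hlam]; linarith
  · right; rwa [le_div_iff₀ hlam]

theorem continuous_waveSymbol {χ : ℝ → ℝ} (hχ : IsCutoff χ) (d : ℕ) {lam : ℝ} (hlam : 0 < lam)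
    (τ : ℝ) : Continuous (waveSymbol χ d lam τ) := by
  have h := (hasTemperateGrowth_localizedWave_symbol hχ d hlam τ).1.continuous
  have h2 := h.comp (continuous_const_smul (2 * Real.pi)⁻¹)
  have hπ : 2 * Real.pi ≠ 0 := by positivity
  simp only [Function.comp_def, smul_inv_smul₀ hπ] at h2
  exact h2

theorem hasCompactSupport_waveSymbol {χ : ℝ → ℝ} (hχ : IsCutoff χ) (d : ℕ) {lam : ℝ}
    (hlam : 0 < lam) (τ : ℝ) : HasCompactSupport (waveSymbol χ d lam τ) := by
  refine HasCompactSupport.intro (isCompact_closedBall 0 (2 * lam)) fun ξ hξ => ?_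
  have hbig : 2 * lam < ‖ξ‖ := by simpa using hξ
  exact waveSymbol_eq_zero hχ hlam τ (Or.inr hbig.le)

theorem norm_waveSymbol_le {χ : ℝ → ℝ} {β' : ℝ → ℝ} {B : ℝ}
    (h : ProfileBound (fun s => χ s - χ (2 * s)) β' B) (d : ℕ) (lam τ : ℝ)
    (ξ : EuclideanSpace ℝ (Fin d)) : ‖waveSymbol χ d lam τ ξ‖ ≤ B := by
  rw [waveSymbol, norm_mul, norm_propagatorSymbol, one_mul, Complex.norm_real]
  exact h.abs_le _

/-- The kernel `∫ e^{i x·ξ} a(ξ) dξ` of `(2π)^d a(D)`, where `a` is the symbol of the localized free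
wave. -/
noncomputable def waveKernel (χ : ℝ → ℝ) (d : ℕ) (lam τ : ℝ) (x : EuclideanSpace ℝ (Fin d)) : ℂ :=
  ∫ ξ, Complex.exp (Complex.I * (inner ℝ x ξ : ℝ)) * waveSymbol χ d lam τ ξ

theorem mul_sqrt_tanh_div {r : ℝ} (hr : 0 < r) : r * √(Real.tanh r / r) = waveFreq r := by
  have h := (real_tanh_pos hr).le
  rw [waveFreq, ← Real.sqrt_sq hr.le, ← Real.sqrt_mul (sq_nonneg r), Real.sqrt_sq hr.le]
  congr 1
  field_simp

/-- Integrals over the half line of a function supported in the dyadic shell. -/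
theorem setIntegral_Ioi_eq_intervalIntegral {f g : ℝ → ℂ} {lam : ℝ} (hlam : 0 < lam)
    (h0 : ∀ r, 0 < r → (r ≤ lam / 2 ∨ 2 * lam ≤ r) → f r = 0)
    (hfg : ∀ r, 0 < r → f r = g r) :
    ∫ r in Set.Ioi 0, f r = ∫ r in lam / 2..2 * lam, g r := by
  rw [intervalIntegral.integral_of_le (by linarith),
    setIntegral_eq_of_subset_of_forall_sdiff_eq_zero measurableSet_Ioi
      (s := Set.Ioc (lam / 2) (2 * lam))
      (fun r hr => lt_trans (by positivity : 0 < lam / 2) hr.1)]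
  · exact setIntegral_congr_fun measurableSet_Ioc fun r hr =>
      hfg r (lt_trans (by positivity) hr.1)
  · intro r hr
    refine h0 r hr.1 ?_
    by_contra hcon
    push Not at hcon
    exact hr.2 ⟨hcon.1, hcon.2.le⟩

/-- In dimension one each half line contributes a radial integral, the negative one with the signs
of `x` and `τ` reversed because `m₁` is odd. -/
theorem exists_norm_waveKernel_one_le {χ : ℝ → ℝ} (hχ : IsCutoff χ) :
    ∃ C : ℝ, ∀ lam τ : ℝ, 2 ≤ lam → τ ≠ 0 → ∀ x : EuclideanSpace ℝ (Fin 1),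
      ‖waveKernel χ 1 lam τ x‖ ≤ C * dispersiveRate lam τ := by
  obtain ⟨β', B, hB⟩ := hχ.exists_profileBound
  refine ⟨360 * B, fun lam τ hlam hτ x => ?_⟩
  have hl : 0 < lam := by linarith
  set U := (OrthonormalBasis.singleton (Fin 1) ℝ).repr with hU
  have hU0 : ∀ s, U s 0 = s := fun s => OrthonormalBasis.singleton_repr s 0
  have hUn : ∀ s, ‖U s‖ = |s| := fun s => U.norm_map s
  set h : ℝ → ℂ := fun s =>
    Complex.exp (Complex.I * (inner ℝ x (U s) : ℝ)) * waveSymbol χ 1 lam τ (U s) with hh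
  have e0 : waveKernel χ 1 lam τ x = ∫ s, h s :=
    (U.measurePreserving.integral_comp U.toHomeomorph.measurableEmbedding _).symm
  have hcont : Continuous h := by
    have := continuous_waveSymbol hχ 1 hl τ
    have := U.continuous
    simp only [hh]
    fun_prop
  have hz : ∀ s, (|s| ≤ lam / 2 ∨ 2 * lam ≤ |s|) → h s = 0 := fun s hs => by
    simp only [hh]
    rw [waveSymbol_eq_zero hχ hl τ (by rwa [hUn]), mul_zero]
  have hint : Integrable h := by
    refine hcont.integrable_of_hasCompactSupport
      (HasCompactSupport.intro (isCompact_Icc (a := -(2 * lam)) (b := 2 * lam)) fun s hs => ?_)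
    refine hz s (Or.inr ?_)
    by_contra hcon
    exact hs (abs_le.1 (not_le.1 hcon).le)
  have hval : ∀ s, h s = Complex.exp (Complex.I * (x 0 * s : ℝ)) *
      (Complex.exp (-(Complex.I * τ * (s * √(Real.tanh s / s) : ℝ)))
        * ((χ (|s| / lam) - χ (2 * (|s| / lam)) : ℝ) : ℂ)) := by
    intro s
    have e1 : inner ℝ x (U s) = x 0 * s := by
      simp [PiLp.inner_apply, hU0, mul_comm]
    simp only [hh, e1, waveSymbol, propagatorSymbol, projectionSymbol, hUn, dispersionSymbol, hU0]
  have e1 : ∫ s in Set.Ioi 0, h s = ∫ r in lam / 2..2 * lam,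
      Complex.exp (Complex.I * radialPhase (x 0) τ r) *
        ((χ (r / lam) - χ (2 * (r / lam)) : ℝ) : ℂ) := by
    refine setIntegral_Ioi_eq_intervalIntegral hl (fun r hr h => hz r (by rwa [abs_of_pos hr]))
      fun r hr => ?_
    rw [hval, abs_of_pos hr, mul_sqrt_tanh_div hr, ← mul_assoc, ← Complex.exp_add]
    congr 2
    simp only [radialPhase]
    push_cast
    ring
  have e2 : ∫ s in Set.Iic 0, h s = ∫ r in lam / 2..2 * lam,
      Complex.exp (Complex.I * radialPhase (-x 0) (-τ) r) *
        ((χ (r / lam) - χ (2 * (r / lam)) : ℝ) : ℂ) := by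
    have := integral_comp_neg_Ioi 0 h
    rw [neg_zero] at this
    rw [← this]
    refine setIntegral_Ioi_eq_intervalIntegral hl
      (fun r hr h => hz (-r) (by rwa [abs_neg, abs_of_pos hr])) fun r hr => ?_
    rw [hval, abs_neg, abs_of_pos hr, Real.tanh_neg, neg_div_neg_eq, neg_mul, mul_sqrt_tanh_div hr,
      ← mul_assoc, ← Complex.exp_add]
    congr 2
    simp only [radialPhase]
    push_cast
    ring
  rw [e0, ← intervalIntegral.integral_Iic_add_Ioi hint.integrableOn hint.integrableOn, e1, e2]
  refine (norm_add_le _ _).trans ?_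
  have b1 := hB.norm_integral_le hlam hτ (x 0)
  have b2 := hB.norm_integral_le hlam (neg_ne_zero.2 hτ) (-x 0)
  rw [dispersiveRate_neg] at b2
  linarith

/-- The integral over the circle does not depend on where the angle is measured from. -/
theorem integral_cexp_mul_cos_sub (z α : ℝ) :
    ∫ θ in -Real.pi..Real.pi, Complex.exp (Complex.I * (z * Real.cos (θ - α) : ℝ))
      = besselMoment 0 z := by
  have hper : Function.Periodic (fun θ => Complex.exp (Complex.I * (z * Real.cos θ : ℝ)))
      (2 * Real.pi) := fun θ => by simp only [Real.cos_add_two_pi]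
  rw [intervalIntegral.integral_comp_sub_right
    (fun θ => Complex.exp (Complex.I * (z * Real.cos θ : ℝ))),
    show Real.pi - α = (-Real.pi - α) + 2 * Real.pi by ring, hper.intervalIntegral_add_eq _
      (-Real.pi), besselMoment, show -Real.pi + 2 * Real.pi = Real.pi by ring]
  simp only [pow_zero, one_mul]

/-- In dimension two the kernel is radial, and polar coordinates reduce it to one integral over the
shell with a Bessel function. -/
theorem exists_norm_waveKernel_two_le {χ : ℝ → ℝ} (hχ : IsCutoff χ) :
    ∃ C : ℝ, ∀ lam τ : ℝ, 2 ≤ lam → τ ≠ 0 → ∀ x : EuclideanSpace ℝ (Fin 2),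
      ‖waveKernel χ 2 lam τ x‖ ≤ C * dispersiveRate lam τ ^ 2 := by
  obtain ⟨β', B, hB⟩ := hχ.exists_profileBound
  obtain ⟨C, hC⟩ := hB.exists_norm_integral_mul_besselMoment_le
  refine ⟨C, fun lam τ hlam hτ x => ?_⟩
  have hl : 0 < lam := by linarith
  set U := Complex.orthonormalBasisOneI.repr with hU
  have hUn : ∀ w, ‖U w‖ = ‖w‖ := fun w => U.norm_map w
  set h : ℂ → ℂ := fun w =>
    Complex.exp (Complex.I * (inner ℝ x (U w) : ℝ)) * waveSymbol χ 2 lam τ (U w) with hh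
  have e0 : waveKernel χ 2 lam τ x = ∫ w, h w :=
    (U.measurePreserving.integral_comp U.toHomeomorph.measurableEmbedding _).symm
  have hcont : Continuous h := by
    have := continuous_waveSymbol hχ 2 hl τ
    have := U.continuous
    simp only [hh]
    fun_prop
  have hz : ∀ w, (‖w‖ ≤ lam / 2 ∨ 2 * lam ≤ ‖w‖) → h w = 0 := fun s hs => by
    simp only [hh]
    rw [waveSymbol_eq_zero hχ hl τ (by rwa [hUn]), mul_zero]
  set w₀ : ℂ := U.symm x with hw₀
  have hinner : ∀ r θ : ℝ, inner ℝ x (U (r * (Real.cos θ + Real.sin θ * Complex.I)))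
      = ‖w₀‖ * r * Real.cos (θ - w₀.arg) := by
    intro r θ
    have e1 : inner ℝ x (U (r * (Real.cos θ + Real.sin θ * Complex.I)))
        = inner ℝ w₀ (r * (Real.cos θ + Real.sin θ * Complex.I)) := by
      rw [hw₀, ← U.inner_map_map, U.apply_symm_apply]
    rw [e1, Complex.inner, Real.cos_sub]
    have h1 := Complex.norm_mul_cos_arg w₀
    have h2 := Complex.norm_mul_sin_arg w₀
    simp
    rw [← h1, ← h2, Complex.cos_ofReal_re, Complex.sin_ofReal_re]
    ring
  set F : ℝ × ℝ → ℂ := fun p => p.1 • h (Complex.polarCoord.symm p) with hF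
  have hnp : ∀ p : ℝ × ℝ, 0 < p.1 → ‖Complex.polarCoord.symm p‖ = p.1 := fun p hp => by
    rw [Complex.norm_polarCoord_symm, abs_of_pos hp]
  have hFc : Continuous F := by
    have : Continuous fun p : ℝ × ℝ => Complex.polarCoord.symm p := by
      simp only [Complex.polarCoord_symm_apply]
      have h1 := Real.continuous_cos
      have h2 := Real.continuous_sin
      fun_prop
    simp only [hF]
    fun_prop
  have hFi : IntegrableOn F (Set.Ioi (0 : ℝ) ×ˢ Set.Ioo (-Real.pi) Real.pi)
      (volume.prod volume) := by
    have h1 : IntegrableOn F (Set.Icc 0 (2 * lam) ×ˢ Set.Icc (-Real.pi) Real.pi)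
        (volume.prod volume) :=
      hFc.continuousOn.integrableOn_compact (isCompact_Icc.prod isCompact_Icc)
    refine h1.of_forall_sdiff_eq_zero (measurableSet_Ioi.prod measurableSet_Ioo) fun p hp => ?_
    have hp1 : 0 < p.1 := hp.1.1
    simp only [hF]
    rw [hz _ (Or.inr ?_), smul_zero]
    rw [hnp p hp1]
    by_contra hcon
    exact hp.2 ⟨⟨hp1.le, (not_le.1 hcon).le⟩, hp.1.2.1.le, hp.1.2.2.le⟩
  have e2 : ∫ w, h w = ∫ r in Set.Ioi 0, ∫ θ in Set.Ioo (-Real.pi) Real.pi, F (r, θ) := by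
    rw [← Complex.integral_comp_polarCoord_symm, Measure.volume_eq_prod]
    exact setIntegral_prod F hFi
  have e3 : ∫ r in Set.Ioi 0, ∫ θ in Set.Ioo (-Real.pi) Real.pi, F (r, θ)
      = ∫ r in lam / 2..2 * lam, Complex.exp (Complex.I * radialPhase 0 τ r)
        * ((r * (χ (r / lam) - χ (2 * (r / lam))) : ℝ) : ℂ) * besselMoment 0 (‖w₀‖ * r) := by
    refine setIntegral_Ioi_eq_intervalIntegral hl (fun r hr hr' => ?_) fun r hr => ?_
    · simp only [hF]
      rw [setIntegral_eq_zero_of_forall_eq_zero]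
      intro θ _
      rw [hz _ (by rwa [hnp (r, θ) hr]), smul_zero]
    · rw [← integral_Ioc_eq_integral_Ioo, ← intervalIntegral.integral_of_le
        (by linarith [Real.pi_pos]), ← integral_cexp_mul_cos_sub _ w₀.arg,
        ← intervalIntegral.integral_const_mul]
      congr 1
      funext θ
      have hn : ‖U (r * (Real.cos θ + Real.sin θ * Complex.I))‖ = r := by
        have := hnp (r, θ) hr
        rwa [Complex.polarCoord_symm_apply, ← hUn] at this
      simp only [hF, hh]
      rw [Complex.polarCoord_symm_apply]
      simp only [hinner]
      rw [waveSymbol, propagatorSymbol, projectionSymbol, dispersionSymbol, hn,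
        mul_sqrt_tanh_div hr]
      · simp only [radialPhase, Complex.real_smul]
        push_cast
        rw [show Complex.I * (0 * (r : ℂ) - τ * waveFreq r) = -(Complex.I * τ * waveFreq r) by ring]
        ring
      · simp
  rw [e0, e2, e3]
  exact hC lam τ ‖w₀‖ hlam hτ (norm_nonneg _)

/-! ### Fourier multipliers between Lebesgue spaces -/

section Multiplier

variable {E : Type*} [NormedAddCommGroup E] [InnerProductSpace ℝ E] [FiniteDimensional ℝ E]
  [MeasurableSpace E] [BorelSpace E]

theorem ae_eq_of_toTemperedDistribution_eq {p q : ℝ≥0∞} [hp : Fact (1 ≤ p)] [hq : Fact (1 ≤ q)]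
    {f : Lp ℂ p (volume : Measure E)} {g : Lp ℂ q (volume : Measure E)}
    (h : Lp.toTemperedDistribution f = Lp.toTemperedDistribution g) : f =ᵐ[volume] g := by
  refine ae_eq_of_integral_contDiff_smul_eq ((Lp.memLp f).locallyIntegrable hp.elim)
    ((Lp.memLp g).locallyIntegrable hq.elim) fun u u_smooth u_cpt => ?_
  have hu₁ : HasCompactSupport (Complex.ofRealCLM ∘ u) := u_cpt.comp_left rfl
  have hu₂ : ContDiff ℝ ∞ (Complex.ofRealCLM ∘ u) := by fun_prop
  have := congrArg (fun T : 𝓢'(E, ℂ) => T (hu₁.toSchwartzMap hu₂)) h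
  simpa using this

theorem toTemperedDistribution_congr_ae {p q : ℝ≥0∞} [Fact (1 ≤ p)] [Fact (1 ≤ q)]
    {f : Lp ℂ p (volume : Measure E)} {g : Lp ℂ q (volume : Measure E)} (h : f =ᵐ[volume] g) :
    Lp.toTemperedDistribution f = Lp.toTemperedDistribution g := by
  ext u
  rw [Lp.toTemperedDistribution_apply, Lp.toTemperedDistribution_apply]
  exact integral_congr_ae (h.mono fun x hx => by simp only [hx])

theorem toTemperedDistribution_injective {p : ℝ≥0∞} [Fact (1 ≤ p)]
    {f g : Lp ℂ p (volume : Measure E)}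
    (h : Lp.toTemperedDistribution f = Lp.toTemperedDistribution g) : f = g :=
  Lp.ext (ae_eq_of_toTemperedDistribution_eq h)

/-- The operator `T` on tempered distributions maps `f ∈ L^p` into `L^q`, with norm at most
`C ‖f‖`. -/
def MapsLpBound (T : 𝓢'(E, ℂ) →L[ℂ] 𝓢'(E, ℂ)) (q : ℝ≥0∞) [Fact (1 ≤ q)] (C : ℝ) {p : ℝ≥0∞}
    [Fact (1 ≤ p)] (f : Lp ℂ p (volume : Measure E)) : Prop :=
  ∃ g : Lp ℂ q (volume : Measure E),
    T (Lp.toTemperedDistribution f) = Lp.toTemperedDistribution g ∧ ‖g‖ ≤ C * ‖f‖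

/-- A bound `L^p → L^q` on a dense subgroup of `L^p` extends to `L^p`. -/
theorem mapsLpBound_of_dense {T : 𝓢'(E, ℂ) →L[ℂ] 𝓢'(E, ℂ)} {p q : ℝ≥0∞} [Fact (1 ≤ p)]
    [Fact (1 ≤ q)] {C : ℝ} {D : AddSubgroup (Lp ℂ p (volume : Measure E))}
    (hD : Dense (D : Set (Lp ℂ p (volume : Measure E)))) (h : ∀ f ∈ D, MapsLpBound T q C f)
    (f : Lp ℂ p (volume : Measure E)) : MapsLpBound T q C f := by
  obtain ⟨u, huD, hu⟩ := mem_closure_iff_seq_limit.1 (hD f)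
  choose g hg hgn using fun n => h (u n) (huD n)
  have hT : ∀ {r : ℝ≥0∞} [Fact (1 ≤ r)] (f₁ f₂ : Lp ℂ r (volume : Measure E)),
      Lp.toTemperedDistribution (f₁ - f₂)
        = Lp.toTemperedDistribution f₁ - Lp.toTemperedDistribution f₂ := fun f₁ f₂ =>
    map_sub (Lp.toTemperedDistributionCLM ℂ (volume : Measure E) _) f₁ f₂
  have hsub : ∀ m n, ‖g m - g n‖ ≤ C * ‖u m - u n‖ := by
    intro m n
    obtain ⟨v, hv, hvn⟩ := h _ (D.sub_mem (huD m) (huD n))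
    have : g m - g n = v := by
      apply toTemperedDistribution_injective
      rw [← hv, hT, hT, map_sub, hg, hg]
    rw [this]
    exact hvn
  have hcu : CauchySeq u := hu.cauchySeq
  have hcg : CauchySeq g := by
    rw [Metric.cauchySeq_iff'] at hcu ⊢
    intro ε hε
    obtain ⟨N, hN⟩ := hcu (ε / (|C| + 1)) (by positivity)
    refine ⟨N, fun n hn => ?_⟩
    have h1 := hN n hn
    rw [dist_eq_norm] at h1 ⊢
    rw [lt_div_iff₀ (by positivity)] at h1
    calc ‖g n - g N‖ ≤ C * ‖u n - u N‖ := hsub n N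
      _ ≤ (|C| + 1) * ‖u n - u N‖ := by gcongr; linarith [le_abs_self C]
      _ < ε := by linarith
  obtain ⟨G, hG⟩ := cauchySeq_tendsto_of_complete hcg
  refine ⟨G, ?_, le_of_tendsto_of_tendsto hG.norm (hu.norm.const_mul C)
    (Filter.Eventually.of_forall hgn)⟩
  have h1 : Filter.Tendsto (fun n => T (Lp.toTemperedDistribution (u n))) Filter.atTop
      (nhds (T (Lp.toTemperedDistribution f))) :=
    (T.continuous.tendsto _).comp
      (((Lp.toTemperedDistributionCLM ℂ (volume : Measure E) p).continuous.tendsto f).comp hu)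
  have h2 : Filter.Tendsto (fun n => T (Lp.toTemperedDistribution (u n))) Filter.atTop
      (nhds (Lp.toTemperedDistribution G)) := by
    simp only [hg]
    exact ((Lp.toTemperedDistributionCLM ℂ (volume : Measure E) q).continuous.tendsto G).comp hG
  exact tendsto_nhds_unique h1 h2

/-- On Schwartz functions a Fourier multiplier is convolution with the inverse Fourier transform of
its symbol. -/
theorem norm_fourierMultiplierCLM_apply_le {a : E → ℂ} (ha : a.HasTemperateGrowth)
    (hai : Integrable a) {M : ℝ} (hM : ∀ x, ‖𝓕⁻ a x‖ ≤ M) (f : 𝓢(E, ℂ)) (x : E) :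
    ‖SchwartzMap.fourierMultiplierCLM ℂ a f x‖ ≤ M * ∫ y, ‖f y‖ := by
  set g : E → ℂ := fun ζ => Real.fourierChar (inner ℝ ζ x) • a ζ with hg
  have hgi : Integrable g := by
    have hc : Continuous fun ζ : E => (Real.fourierChar (inner ℝ ζ x) : ℂ) := by
      have := Real.continuous_fourierChar
      fun_prop
    simp only [hg, Circle.smul_def]
    refine (hai.norm).mono' (hc.aestronglyMeasurable.smul hai.1) ?_
    exact Filter.Eventually.of_forall fun ζ => by
      rw [norm_smul, Circle.norm_coe, one_mul]
  have e1 : SchwartzMap.fourierMultiplierCLM ℂ a f x = ∫ ζ, 𝓕 (f : E → ℂ) ζ • g ζ := by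
    rw [SchwartzMap.fourierMultiplierCLM_apply, SchwartzMap.fourierInv_coe, Real.fourierInv_eq]
    congr 1
    funext ζ
    rw [SchwartzMap.smulLeftCLM_apply_apply ha, ← SchwartzMap.fourier_coe]
    simp only [hg, Circle.smul_def, smul_eq_mul]
    ring
  have e2 : ∫ ζ, 𝓕 (f : E → ℂ) ζ • g ζ = ∫ y, f y • 𝓕 g y := by
    have := VectorFourier.integral_fourierIntegral_smul_eq_flip (L := innerₗ E) (μ := volume)
      (ν := volume) (f := (f : E → ℂ)) (g := g) Real.continuous_fourierChar continuous_inner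
      f.integrable hgi
    rw [flip_innerₗ] at this
    exact this
  have e3 : ∀ y, 𝓕 g y = 𝓕⁻ a (x - y) := by
    intro y
    rw [Real.fourier_eq, Real.fourierInv_eq]
    congr 1
    funext ζ
    simp only [hg]
    rw [smul_smul, ← AddChar.map_add_eq_mul]
    congr 2
    rw [inner_sub_right]
    ring
  rw [e1, e2, ← integral_const_mul]
  refine norm_integral_le_of_norm_le (f.integrable.norm.const_mul M)
    (Filter.Eventually.of_forall fun y => ?_)
  rw [norm_smul, mul_comm, e3]
  exact mul_le_mul_of_nonneg_right (hM _) (norm_nonneg _)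

theorem norm_Lp_top_le {f : Lp ℂ ∞ (volume : Measure E)} {C : ℝ} (hC : 0 ≤ C)
    (h : ∀ᵐ x, ‖f x‖ ≤ C) : ‖f‖ ≤ C := by
  rw [Lp.norm_def, eLpNorm_exponent_top]
  exact ENNReal.toReal_le_of_le_ofReal hC (eLpNormEssSup_le_of_ae_bound h)

theorem mapsLpBound_one_top {a : E → ℂ} (ha : a.HasTemperateGrowth) (hai : Integrable a) {M : ℝ}
    (hM : ∀ x, ‖𝓕⁻ a x‖ ≤ M) (f : Lp ℂ 1 (volume : Measure E)) :
    MapsLpBound (TemperedDistribution.fourierMultiplierCLM ℂ a) ∞ M f := by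
  have hd := SchwartzMap.denseRange_toLpCLM (E := E) (F := ℂ) (p := 1) (μ := volume)
    ENNReal.one_ne_top
  refine mapsLpBound_of_dense
    (D := (SchwartzMap.toLpCLM ℝ ℂ 1 (volume : Measure E)).toLinearMap.toAddMonoidHom.range)
    (by simpa using! hd) ?_ f
  rintro _ ⟨φ, rfl⟩
  have hM0 : 0 ≤ M := (norm_nonneg _).trans (hM 0)
  refine ⟨(SchwartzMap.fourierMultiplierCLM ℂ a φ).toLp ∞, ?_, ?_⟩
  · have : (SchwartzMap.toLpCLM ℝ ℂ 1 (volume : Measure E)).toLinearMap.toAddMonoidHom φ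
        = φ.toLp 1 := rfl
    rw [this, Lp.toTemperedDistribution_toLp_eq, Lp.toTemperedDistribution_toLp_eq,
      TemperedDistribution.fourierMultiplierCLM_toTemperedDistributionCLM_eq ha]
  · have : (SchwartzMap.toLpCLM ℝ ℂ 1 (volume : Measure E)).toLinearMap.toAddMonoidHom φ
        = φ.toLp 1 := rfl
    rw [this, SchwartzMap.norm_toLp_one]
    refine norm_Lp_top_le (mul_nonneg hM0 (integral_nonneg fun _ => norm_nonneg _)) ?_
    filter_upwards [(SchwartzMap.fourierMultiplierCLM ℂ a φ).coeFn_toLp ∞ volume] with x hx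
    rw [hx]
    exact norm_fourierMultiplierCLM_apply_le ha hai hM φ x

theorem mapsLpBound_two {a : E → ℂ} (ha : a.HasTemperateGrowth) {B : ℝ} (hB : ∀ x, ‖a x‖ ≤ B)
    (f : Lp ℂ 2 (volume : Measure E)) :
    MapsLpBound (TemperedDistribution.fourierMultiplierCLM ℂ a) 2 B f := by
  have hm : MemLp a ∞ (volume : Measure E) :=
    memLp_top_of_bound ha.1.continuous.aestronglyMeasurable B (Filter.Eventually.of_forall hB)
  refine ⟨𝓕⁻ (hm.toLp a • 𝓕 f : Lp ℂ 2 (volume : Measure E)), ?_, ?_⟩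
  · rw [TemperedDistribution.fourierMultiplierCLM_apply, Lp.fourier_toTemperedDistribution_eq,
      ← Lp.toTemperedDistribution_smul_eq (r := 2) ha hm, Lp.fourierInv_toTemperedDistribution_eq]
  · have e1 : ‖𝓕⁻ (hm.toLp a • 𝓕 f : Lp ℂ 2 (volume : Measure E))‖
        = ‖(hm.toLp a • 𝓕 f : Lp ℂ 2 (volume : Measure E))‖ :=
      (Lp.fourierTransformₗᵢ E ℂ).symm.norm_map _
    rw [e1]
    refine (Lp.norm_smul_le _ _).trans ?_
    rw [Lp.norm_fourier_eq]
    refine mul_le_mul_of_nonneg_right (norm_Lp_top_le ((norm_nonneg _).trans (hB 0)) ?_)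
      (norm_nonneg _)
    filter_upwards [hm.coeFn_toLp] with x hx
    rw [hx]
    exact hB x

end Multiplier

theorem fourierInv_waveSymbol_comp (χ : ℝ → ℝ) (d : ℕ) (lam τ : ℝ) (x : EuclideanSpace ℝ (Fin d)) :
    𝓕⁻ (fun ζ => waveSymbol χ d lam τ ((2 * Real.pi) • ζ)) x
      = ((2 * Real.pi) ^ d)⁻¹ • waveKernel χ d lam τ x := by
  have h := Measure.integral_comp_smul (volume : Measure (EuclideanSpace ℝ (Fin d)))
    (fun ξ => Complex.exp (Complex.I * (inner ℝ x ξ : ℝ)) * waveSymbol χ d lam τ ξ) (2 * Real.pi)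
  rw [finrank_euclideanSpace_fin, abs_of_pos (by positivity)] at h
  rw [waveKernel, ← h, Real.fourierInv_eq']
  congr 1
  funext ζ
  rw [smul_eq_mul, inner_smul_right, real_inner_comm, mul_comm Complex.I]

/-- The dispersive bound for the kernel, in both dimensions. -/
theorem exists_norm_waveKernel_le {χ : ℝ → ℝ} (hχ : IsCutoff χ) {d : ℕ} (hd : d = 1 ∨ d = 2) :
    ∃ C : ℝ, ∀ lam τ : ℝ, 2 ≤ lam → τ ≠ 0 → ∀ x : EuclideanSpace ℝ (Fin d),
      ‖waveKernel χ d lam τ x‖ ≤ C * dispersiveRate lam τ ^ d := by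
  rcases hd with rfl | rfl
  · simpa using exists_norm_waveKernel_one_le hχ
  · exact exists_norm_waveKernel_two_le hχ

/-- The two endpoint estimates for the localized free wave. -/
theorem exists_mapsLpBound_localizedWave {χ : ℝ → ℝ} (hχ : IsCutoff χ) {d : ℕ}
    (hd : d = 1 ∨ d = 2) :
    ∃ C : ℝ, 0 < C ∧ ∀ lam τ : ℝ, 2 ≤ lam → τ ≠ 0 →
      (∀ f : Lp ℂ 1 (volume : Measure (EuclideanSpace ℝ (Fin d))),
        MapsLpBound (localizedWave χ d lam τ) ∞ (C * dispersiveRate lam τ ^ d) f) ∧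
      ∀ f : Lp ℂ 2 (volume : Measure (EuclideanSpace ℝ (Fin d))),
        MapsLpBound (localizedWave χ d lam τ) 2 C f := by
  obtain ⟨C, hC⟩ := exists_norm_waveKernel_le hχ hd
  obtain ⟨β', B, hB⟩ := hχ.exists_profileBound
  refine ⟨max (max C B) 1, by positivity, fun lam τ hlam hτ => ?_⟩
  have hl : 0 < lam := by linarith
  have ha := hasTemperateGrowth_localizedWave_symbol hχ d hl τ
  have hP := (dispersiveRate_pos hl hτ).le
  refine ⟨fun f => mapsLpBound_one_top ha ?_ (fun x => ?_) f, fun f => mapsLpBound_two ha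
    (fun x => (norm_waveSymbol_le hB d lam τ _).trans
      ((le_max_right _ _).trans (le_max_left _ _))) f⟩
  · have h1 := (continuous_waveSymbol hχ d hl τ).integrable_of_hasCompactSupport (μ := volume)
      (hasCompactSupport_waveSymbol hχ d hl τ)
    exact h1.comp_smul (by positivity : 2 * Real.pi ≠ 0)
  · have h1 := fourierInv_waveSymbol_comp χ d lam τ x
    simp only [waveSymbol] at h1
    rw [h1, norm_smul, Real.norm_of_nonneg (by positivity)]
    have h2 : ((2 * Real.pi) ^ d)⁻¹ ≤ 1 :=
      inv_le_one_of_one_le₀ (one_le_pow₀ (by linarith [Real.pi_gt_three]))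
    calc _ ≤ 1 * ‖waveKernel χ d lam τ x‖ := by gcongr
      _ ≤ C * dispersiveRate lam τ ^ d := by rw [one_mul]; exact hC lam τ hlam hτ x
      _ ≤ _ := by gcongr; exact (le_max_left _ _).trans (le_max_left _ _)

/-! ### Riesz-Thorin interpolation -/

/-- The analytic family `z ↦ sgn(a) |a|^{p (1 - z/2)}` through `a`. -/
noncomputable def analyticPower (p : ℝ) (a z : ℂ) : ℂ :=
  a / ‖a‖ * Complex.exp (p * (1 - z / 2) * Real.log ‖a‖)

theorem differentiable_analyticPower (p : ℝ) (a : ℂ) : Differentiable ℂ (analyticPower p a) := by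
  unfold analyticPower
  fun_prop

theorem norm_analyticPower {p : ℝ} (a : ℂ) {z : ℂ} (h : p * (1 - z.re / 2) ≠ 0) :
    ‖analyticPower p a z‖ = ‖a‖ ^ (p * (1 - z.re / 2)) := by
  rcases eq_or_ne a 0 with rfl | ha
  · simp [analyticPower, Real.zero_rpow h]
  have hn : 0 < ‖a‖ := norm_pos_iff.2 ha
  have e : ((p : ℂ) * (1 - z / 2) * Real.log ‖a‖).re = p * (1 - z.re / 2) * Real.log ‖a‖ := by
    rw [Complex.re_mul_ofReal, Complex.re_ofReal_mul]
    simp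
  rw [analyticPower, norm_mul, norm_div, Complex.norm_real, norm_norm, div_self hn.ne', one_mul,
    Complex.norm_exp, e, Real.rpow_def_of_pos hn]
  ring_nf

theorem analyticPower_eq {p θ : ℝ} (a : ℂ) (h : p * (1 - θ / 2) = 1) :
    analyticPower p a θ = a := by
  rcases eq_or_ne a 0 with rfl | ha
  · simp [analyticPower]
  have hn : 0 < ‖a‖ := norm_pos_iff.2 ha
  have hn' : (‖a‖ : ℂ) ≠ 0 := by exact_mod_cast hn.ne'
  have e : (p : ℂ) * (1 - θ / 2) = 1 := by exact_mod_cast h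
  rw [analyticPower, e, one_mul, ← Complex.ofReal_exp, Real.exp_log hn, div_mul_cancel₀ _ hn']

theorem norm_analyticPower_le {p : ℝ} (hp : 0 ≤ p) (a : ℂ) {z : ℂ} (h0 : 0 ≤ z.re)
    (h1 : z.re ≤ 1) : ‖analyticPower p a z‖ ≤ Real.exp (p * |Real.log ‖a‖|) := by
  have e : ((p : ℂ) * (1 - z / 2) * Real.log ‖a‖).re = p * ((1 - z.re / 2) * Real.log ‖a‖) := by
    rw [Complex.re_mul_ofReal, Complex.re_ofReal_mul]
    simp
    ring
  have h2 : ‖a / ‖a‖‖ ≤ 1 := by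
    rw [norm_div, Complex.norm_real, norm_norm]
    exact div_self_le_one _
  have h3 : (1 - z.re / 2) * Real.log ‖a‖ ≤ |Real.log ‖a‖| := by
    refine (le_abs_self _).trans ?_
    rw [abs_mul, abs_of_nonneg (by linarith)]
    exact mul_le_of_le_one_left (abs_nonneg _) (by linarith)
  rw [analyticPower, norm_mul, Complex.norm_exp, e]
  calc _ ≤ 1 * Real.exp (p * ((1 - z.re / 2) * Real.log ‖a‖)) := by gcongr
    _ ≤ _ := by rw [one_mul]; gcongr

/-- The `ℓ^p` norm with weights `v`. -/
noncomputable def weightedNorm {ι : Type*} [Fintype ι] (v : ι → ℝ) (p : ℝ) (a : ι → ℂ) : ℝ :=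
  (∑ i, ‖a i‖ ^ p * v i) ^ (1 / p)

/-- The Riesz-Thorin theorem for bilinear forms on finite weighted `ℓ^p` spaces, interpolating
between `ℓ¹ × ℓ¹` and `ℓ² × ℓ²`. -/
theorem norm_le_weightedNorm_of_endpoints {ι κ : Type*} [Fintype ι] [Fintype κ] {v : ι → ℝ}
    {w : κ → ℝ} (hv : ∀ i, 0 ≤ v i) (hw : ∀ j, 0 ≤ w j)
    (Λ : (ι → ℂ) →ₗ[ℂ] (κ → ℂ) →ₗ[ℂ] ℂ) {M₀ M₁ : ℝ} (hM₀ : 0 ≤ M₀) (hM₁ : 0 ≤ M₁)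
    (h0 : ∀ a b, ‖Λ a b‖ ≤ M₀ * weightedNorm v 1 a * weightedNorm w 1 b)
    (h1 : ∀ a b, ‖Λ a b‖ ≤ M₁ * weightedNorm v 2 a * weightedNorm w 2 b)
    {p θ : ℝ} (hθ0 : 0 ≤ θ) (hθ1 : θ ≤ 1) (hp : p * (1 - θ / 2) = 1) (a : ι → ℂ) (b : κ → ℂ) :
    ‖Λ a b‖ ≤ M₀ ^ (1 - θ) * M₁ ^ θ * weightedNorm v p a * weightedNorm w p b := by
  classical
  have hp0 : 0 < p := by
    by_contra hcon
    have : p * (1 - θ / 2) ≤ 0 := mul_nonpos_of_nonpos_of_nonneg (not_lt.1 hcon) (by linarith)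
    linarith
  set A : ℂ → ι → ℂ := fun z i => analyticPower p (a i) z with hA
  set B : ℂ → κ → ℂ := fun z j => analyticPower p (b j) z with hB
  set S : ℝ := ∑ i, ‖a i‖ ^ p * v i with hS
  set T : ℝ := ∑ j, ‖b j‖ ^ p * w j with hT
  have hS0 : 0 ≤ S := Finset.sum_nonneg fun i _ => mul_nonneg (by positivity) (hv i)
  have hT0 : 0 ≤ T := Finset.sum_nonneg fun i _ => mul_nonneg (by positivity) (hw i)
  set F : ℂ → ℂ := fun z => Λ (A z) (B z) with hF
  have hFsum : ∀ z, F z = ∑ i, ∑ j, A z i * (B z j *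
      Λ (fun k => if i = k then 1 else 0) (fun k => if j = k then 1 else 0)) := by
    intro z
    simp only [hF]
    rw [LinearMap.pi_apply_eq_sum_univ Λ (A z), LinearMap.sum_apply]
    refine Finset.sum_congr rfl fun i _ => ?_
    rw [LinearMap.smul_apply, LinearMap.pi_apply_eq_sum_univ _ (B z), Finset.smul_sum]
    rfl
  have hFd : Differentiable ℂ F := by
    rw [funext hFsum]
    have hA' : ∀ i, Differentiable ℂ fun z => A z i := fun i => differentiable_analyticPower p (a i)
    have hB' : ∀ j, Differentiable ℂ fun z => B z j := fun j => differentiable_analyticPower p (b j)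
    fun_prop
  have hFb : BddAbove ((norm ∘ F) '' Complex.HadamardThreeLines.verticalClosedStrip 0 1) := by
    refine ⟨∑ i, ∑ j, Real.exp (p * |Real.log ‖a i‖|) * (Real.exp (p * |Real.log ‖b j‖|) *
      ‖Λ (fun k => if i = k then 1 else 0) (fun k => if j = k then 1 else 0)‖), ?_⟩
    rintro _ ⟨z, hz, rfl⟩
    obtain ⟨hz0, hz1⟩ : 0 ≤ z.re ∧ z.re ≤ 1 := hz
    simp only [Function.comp_apply]
    rw [hFsum]
    refine (norm_sum_le _ _).trans (Finset.sum_le_sum fun i _ => (norm_sum_le _ _).trans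
      (Finset.sum_le_sum fun j _ => ?_))
    rw [norm_mul, norm_mul]
    gcongr
    · exact norm_analyticPower_le hp0.le _ hz0 hz1
    · exact norm_analyticPower_le hp0.le _ hz0 hz1
  -- on the line `Re z = 0` the family has `ℓ¹` norm `S`, on `Re z = 1` it has `ℓ²` norm `S^{1/2}`
  have hl : ∀ z ∈ Complex.re ⁻¹' {(0 : ℝ)}, ‖F z‖ ≤ M₀ * S * T := by
    intro z hz
    have hz0 : z.re = 0 := hz
    refine (h0 _ _).trans (le_of_eq ?_)
    have e : ∀ c : ℂ, ‖analyticPower p c z‖ = ‖c‖ ^ p := fun c => by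
      rw [norm_analyticPower _ (by rw [hz0]; simpa using hp0.ne'), hz0]; simp
    simp only [weightedNorm, hA, hB, e, Real.rpow_one, div_one, hS, hT]
  have hr : ∀ z ∈ Complex.re ⁻¹' {(1 : ℝ)}, ‖F z‖ ≤ M₁ * S ^ (1 / 2 : ℝ) * T ^ (1 / 2 : ℝ) := by
    intro z hz
    have hz1 : z.re = 1 := hz
    refine (h1 _ _).trans (le_of_eq ?_)
    have e : ∀ c : ℂ, ‖analyticPower p c z‖ ^ (2 : ℝ) = ‖c‖ ^ p := fun c => by
      rw [norm_analyticPower _ (by rw [hz1]; norm_num; exact hp0.ne'), hz1,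
        ← Real.rpow_mul (norm_nonneg _)]
      congr 1
      ring
    simp only [weightedNorm, hA, hB, e, hS, hT]
  have hmem : (θ : ℂ) ∈ Complex.HadamardThreeLines.verticalClosedStrip 0 1 := by
    rw [Complex.HadamardThreeLines.verticalClosedStrip]
    exact ⟨by simpa using hθ0, by simpa using hθ1⟩
  have key := Complex.HadamardThreeLines.norm_le_interp_of_mem_verticalClosedStrip' zero_lt_one hmem
    hFd.diffContOnCl hFb hl hr
  have hFθ : F θ = Λ a b := by
    simp only [hF, hA, hB, analyticPower_eq _ hp]
  rw [hFθ] at key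
  refine key.trans (le_of_eq ?_)
  have hp' : 1 / p = 1 - θ / 2 := by rw [div_eq_iff hp0.ne', mul_comm, hp]
  have hST : ∀ x : ℝ, 0 ≤ x → x ^ (1 - θ) * (x ^ (1 / 2 : ℝ)) ^ θ = x ^ (1 / p) := by
    intro x hx
    rw [← Real.rpow_mul hx, ← Real.rpow_add_of_nonneg hx (by linarith) (by positivity), hp']
    congr 1
    ring
  simp only [Complex.ofReal_re, sub_zero, div_one, weightedNorm]
  rw [Real.mul_rpow (by positivity) hT0, Real.mul_rpow hM₀ hS0,
    Real.mul_rpow (by positivity) (by positivity), Real.mul_rpow hM₁ (by positivity), ← hST S hS0,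
    ← hST T hT0]
  ring

/-! ### Step functions and duality -/

section StepFunctions

variable {X ι : Type*} [Fintype ι] {E : ι → Set X}

/-- The step function with the value `a i` on `E i`. -/
noncomputable def stepFun (E : ι → Set X) (a : ι → ℂ) (x : X) : ℂ :=
  ∑ i, (E i).indicator (fun _ => a i) x

theorem norm_stepFun_rpow (hdisj : Pairwise fun i j => Disjoint (E i) (E j)) {p : ℝ} (hp : p ≠ 0)
    (a : ι → ℂ) (x : X) :
    ‖stepFun E a x‖ ^ p = ∑ i, (E i).indicator (fun _ => ‖a i‖ ^ p) x := by
  classical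
  by_cases h : ∃ i, x ∈ E i
  · obtain ⟨i, hi⟩ := h
    have hne : ∀ j, j ≠ i → x ∉ E j := fun j hj hx =>
      Set.disjoint_left.1 (hdisj hj) hx hi
    rw [stepFun, Finset.sum_eq_single i, Finset.sum_eq_single i, Set.indicator_of_mem hi,
      Set.indicator_of_mem hi]
    all_goals simp +contextual [Set.indicator_of_notMem, hne]
  · push Not at h
    simp [stepFun, Set.indicator_of_notMem, h, Real.zero_rpow hp]

variable [MeasurableSpace X] {μ : Measure X}

theorem memLp_stepFun (hE : ∀ i, MeasurableSet (E i)) (hfin : ∀ i, μ (E i) ≠ ⊤) (p : ℝ≥0∞)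
    (a : ι → ℂ) : MemLp (stepFun E a) p μ := by
  have : stepFun E a = ∑ i, (E i).indicator (fun _ => a i) := by
    funext x; simp [stepFun]
  rw [this]
  exact memLp_finsetSum' _ fun i _ => memLp_indicator_const p (hE i) (a i) (Or.inr (hfin i))

/-- Step functions as elements of `L^p`, linearly in the values. -/
noncomputable def stepLp (hE : ∀ i, MeasurableSet (E i)) (hfin : ∀ i, μ (E i) ≠ ⊤) (p : ℝ≥0∞) :
    (ι → ℂ) →ₗ[ℂ] Lp ℂ p μ where
  toFun a := (memLp_stepFun hE hfin p a).toLp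
  map_add' a b := by
    rw [← MemLp.toLp_add]
    apply MemLp.toLp_congr
    refine Filter.Eventually.of_forall fun x => ?_
    simp only [stepFun, Pi.add_apply, ← Finset.sum_add_distrib]
    refine Finset.sum_congr rfl fun i _ => ?_
    by_cases h : x ∈ E i <;> simp [h]
  map_smul' c a := by
    rw [RingHom.id_apply, ← MemLp.toLp_const_smul]
    apply MemLp.toLp_congr
    refine Filter.Eventually.of_forall fun x => ?_
    simp only [stepFun, Pi.smul_apply, Finset.smul_sum]
    refine Finset.sum_congr rfl fun i _ => ?_
    by_cases h : x ∈ E i <;> simp [h]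

theorem coeFn_stepLp (hE : ∀ i, MeasurableSet (E i)) (hfin : ∀ i, μ (E i) ≠ ⊤) (p : ℝ≥0∞)
    (a : ι → ℂ) : stepLp hE hfin p a =ᵐ[μ] stepFun E a :=
  (memLp_stepFun hE hfin p a).coeFn_toLp

theorem norm_stepLp (hE : ∀ i, MeasurableSet (E i)) (hfin : ∀ i, μ (E i) ≠ ⊤)
    (hdisj : Pairwise fun i j => Disjoint (E i) (E j)) {p : ℝ≥0∞} (hp0 : p ≠ 0) (hp : p ≠ ⊤)
    (a : ι → ℂ) :
    ‖stepLp hE hfin p a‖ = weightedNorm (fun i => μ.real (E i)) p.toReal a := by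
  have hpr : 0 < p.toReal := ENNReal.toReal_pos hp0 hp
  have hm := memLp_stepFun hE hfin p a
  rw [Lp.norm_def, eLpNorm_congr_ae (coeFn_stepLp hE hfin p a),
    hm.eLpNorm_eq_integral_rpow_norm hp0 hp, ENNReal.toReal_ofReal (by positivity), weightedNorm,
    one_div]
  congr 1
  simp only [norm_stepFun_rpow hdisj hpr.ne']
  rw [integral_finsetSum]
  · refine Finset.sum_congr rfl fun i _ => ?_
    rw [integral_indicator_const _ (hE i), smul_eq_mul, mul_comm]
  · intro i _
    exact (integrable_indicator_iff (hE i)).2 (integrableOn_const (hfin i))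

/-- Every simple function in `L^p`, `p < ⊤`, is a step function over disjoint sets of finite
measure. -/
theorem exists_eq_stepFun (f : SimpleFunc X ℂ) {p : ℝ≥0∞} (hp0 : p ≠ 0) (hp : p ≠ ⊤)
    (hf : MemLp f p μ) :
    ∃ (s : Finset ℂ) (E : s → Set X) (a : s → ℂ), (∀ i, MeasurableSet (E i)) ∧
      (∀ i, μ (E i) ≠ ⊤) ∧ (Pairwise fun i j => Disjoint (E i) (E j)) ∧ ⇑f = stepFun E a := by
  classical
  refine ⟨f.range.filter (· ≠ 0), fun i => f ⁻¹' {(i : ℂ)}, fun i => i,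
    fun i => f.measurableSet_fiber _, fun i => ?_, fun i j hij => ?_, ?_⟩
  · exact (SimpleFunc.measure_preimage_lt_top_of_memLp hp0 hp f hf _
      (Finset.mem_filter.1 i.2).2).ne
  · refine Set.disjoint_left.2 fun x hx hy => hij (Subtype.ext ?_)
    exact (Set.mem_singleton_iff.1 hx).symm.trans (Set.mem_singleton_iff.1 hy)
  · funext x
    by_cases h : f x = 0
    · rw [stepFun, h, Finset.sum_eq_zero]
      intro i _
      refine Set.indicator_of_notMem (fun hx => ?_) _
      exact (Finset.mem_filter.1 i.2).2 ((Set.mem_singleton_iff.1 hx).symm.trans h)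
    · have hmem : f x ∈ f.range.filter (· ≠ 0) :=
        Finset.mem_filter.2 ⟨f.mem_range_self x, h⟩
      rw [stepFun, Finset.sum_eq_single ⟨f x, hmem⟩]
      · rw [Set.indicator_of_mem (by simp)]
      · intro j _ hj
        refine Set.indicator_of_notMem (fun hx => hj (Subtype.ext ?_)) _
        exact (Set.mem_singleton_iff.1 hx).symm
      · simp

end StepFunctions

section Duality

variable {X : Type*} [MeasurableSpace X] {μ : Measure X}

/-- The bilinear pairing `∫ f g` of conjugate Lebesgue spaces. -/
noncomputable def lpPair (μ : Measure X) (p q : ℝ≥0∞) [Fact (1 ≤ p)] [Fact (1 ≤ q)]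
    [ENNReal.HolderConjugate p q] : Lp ℂ p μ →L[ℂ] Lp ℂ q μ →L[ℂ] ℂ :=
  (ContinuousLinearMap.mul ℂ ℂ).lpPairing μ p q

theorem lpPair_apply {p q : ℝ≥0∞} [Fact (1 ≤ p)] [Fact (1 ≤ q)] [ENNReal.HolderConjugate p q]
    (f : Lp ℂ p μ) (g : Lp ℂ q μ) : lpPair μ p q f g = ∫ x, f x * g x ∂μ := by
  rw [lpPair, ContinuousLinearMap.lpPairing_eq_integral]
  rfl

theorem norm_lpPair_le {p q : ℝ≥0∞} [Fact (1 ≤ p)] [Fact (1 ≤ q)] [ENNReal.HolderConjugate p q]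
    (f : Lp ℂ p μ) (g : Lp ℂ q μ) : ‖lpPair μ p q f g‖ ≤ ‖f‖ * ‖g‖ := by
  set B := ContinuousLinearMap.mul ℂ ℂ with hB
  have e : lpPair μ p q f g = ∫ x, (B.holder 1 f g : Lp ℂ 1 μ) x ∂μ := by
    rw [lpPair_apply]
    exact integral_congr_ae ((B.coeFn_holder f g).mono fun x hx => by rw [hx]; rfl)
  have e2 : ‖∫ x, (B.holder 1 f g : Lp ℂ 1 μ) x ∂μ‖ ≤ ‖(B.holder 1 f g : Lp ℂ 1 μ)‖ := by
    rw [← L1.integral_eq_integral]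
    exact L1.norm_integral_le _
  rw [e]
  refine e2.trans ((B.norm_holder_apply_apply_le f g).trans ?_)
  have : ‖B‖ ≤ 1 := ContinuousLinearMap.opNorm_mul_le ℂ ℂ
  rw [mul_assoc]
  exact mul_le_of_le_one_left (by positivity) this

/-- The `L^r` norm is attained by testing against `conj u |u|^{r-2}`; simple test functions
suffice by density. -/
theorem norm_le_of_forall_simpleFunc {r r' : ℝ≥0∞} [Fact (1 ≤ r)] [Fact (1 ≤ r')]
    [hrr : ENNReal.HolderConjugate r r'] (hr : r ≠ ⊤) (hr' : r' ≠ ⊤) (u : Lp ℂ r μ) {M : ℝ}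
    (hM : 0 ≤ M) (h : ∀ g ∈ Lp.simpleFunc ℂ r' μ, ‖lpPair μ r r' u g‖ ≤ M * ‖g‖) : ‖u‖ ≤ M := by
  have hall : ∀ g, ‖lpPair μ r r' u g‖ ≤ M * ‖g‖ := by
    intro g
    refine (Lp.simpleFunc.dense hr').induction (P := fun g => ‖lpPair μ r r' u g‖ ≤ M * ‖g‖)
      h (isClosed_le (by fun_prop) (by fun_prop)) g
  have hconj : r.toReal.HolderConjugate r'.toReal :=
    ENNReal.HolderConjugate.toReal_of_ne_top hr hr'
  set R := r.toReal with hR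
  set R' := r'.toReal with hR'
  have hR0 : 0 < R := hconj.pos
  have hR'0 : 0 < R' := hconj.symm.pos
  have hr0 : r ≠ 0 := fun h0 => by simp [hR, h0] at hR0
  have hr'0 : r' ≠ 0 := fun h0 => by simp [hR', h0] at hR'0
  set g₀ : X → ℂ := fun x => (starRingEnd ℂ) (u x) * ((‖u x‖ ^ (R - 2) : ℝ) : ℂ) with hg₀
  have hu := Lp.memLp u
  have hum : AEStronglyMeasurable g₀ μ := by
    have h1 := hu.1
    have h2 : AEMeasurable (fun x => ‖u x‖ ^ (R - 2)) μ := h1.norm.aemeasurable.pow_const _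
    exact (Complex.continuous_conj.comp_aestronglyMeasurable h1).mul
      (Complex.continuous_ofReal.comp_aestronglyMeasurable h2.aestronglyMeasurable)
  have hng : ∀ x, ‖g₀ x‖ ^ R' = ‖u x‖ ^ R := by
    intro x
    rcases eq_or_ne (u x) 0 with h0 | h0
    · simp [hg₀, h0, Real.zero_rpow hR0.ne', Real.zero_rpow hR'0.ne']
    have hpos : 0 < ‖u x‖ := norm_pos_iff.2 h0
    have e1 : ‖g₀ x‖ = ‖u x‖ ^ (R - 1) := by
      simp only [hg₀, norm_mul, RCLike.norm_conj, Complex.norm_real]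
      rw [Real.norm_of_nonneg (by positivity)]
      nth_rewrite 1 [← Real.rpow_one ‖u x‖]
      rw [← Real.rpow_add hpos]
      congr 1; ring
    rw [e1, ← Real.rpow_mul hpos.le, hconj.sub_one_mul_conj]
  have hui : Integrable (fun x => ‖u x‖ ^ R) μ := hu.integrable_norm_rpow hr0 hr
  have hgm : MemLp g₀ r' μ := by
    rw [← integrable_norm_rpow_iff hum hr'0 hr']
    exact hui.congr (Filter.Eventually.of_forall fun x => (hng x).symm)
  have hN : ‖u‖ = (∫ x, ‖u x‖ ^ R ∂μ) ^ R⁻¹ := by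
    rw [Lp.norm_def, hu.eLpNorm_eq_integral_rpow_norm hr0 hr, ENNReal.toReal_ofReal (by positivity)]
  have hgN : ‖hgm.toLp‖ = (∫ x, ‖u x‖ ^ R ∂μ) ^ R'⁻¹ := by
    rw [Lp.norm_toLp, hgm.eLpNorm_eq_integral_rpow_norm hr'0 hr',
      ENNReal.toReal_ofReal (by positivity)]
    simp only [← hR', hng]
  have hpair : lpPair μ r r' u hgm.toLp = ((∫ x, ‖u x‖ ^ R ∂μ : ℝ) : ℂ) := by
    rw [lpPair_apply, ← integral_complex_ofReal]
    refine integral_congr_ae (hgm.coeFn_toLp.mono fun x hx => ?_)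
    simp only [hx]
    simp only [hg₀]
    rw [← mul_assoc, Complex.mul_conj, Complex.normSq_eq_norm_sq, ← Complex.ofReal_mul]
    congr 1
    rcases eq_or_ne (u x) 0 with h0 | h0
    · simp [h0, Real.zero_rpow hR0.ne']
    have hpos : 0 < ‖u x‖ := norm_pos_iff.2 h0
    rw [← Real.rpow_natCast, ← Real.rpow_add hpos]
    congr 1; push_cast; ring
  set N := ∫ x, ‖u x‖ ^ R ∂μ with hNdef
  have hN0 : 0 ≤ N := integral_nonneg fun x => by positivity
  have hfin := hall hgm.toLp
  rw [hpair, hgN, Complex.norm_real, Real.norm_of_nonneg hN0] at hfin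
  rcases hN0.eq_or_lt with h0 | hpos
  · rwa [hN, ← h0, Real.zero_rpow (inv_ne_zero hR0.ne')]
  · have e : N = N ^ R⁻¹ * N ^ R'⁻¹ := by
      rw [← Real.rpow_add hpos, hconj.inv_add_inv_eq_one, Real.rpow_one]
    rw [hN]
    have h3 : 0 < N ^ R'⁻¹ := by positivity
    nth_rewrite 1 [e] at hfin
    exact le_of_mul_le_mul_right hfin h3

end Duality

/-! ### Interpolation of operators on tempered distributions -/

section Interpolation

variable {E : Type*} [NormedAddCommGroup E] [InnerProductSpace ℝ E] [FiniteDimensional ℝ E]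
  [MeasurableSpace E] [BorelSpace E] {T : 𝓢'(E, ℂ) →L[ℂ] 𝓢'(E, ℂ)} {M₀ M₁ : ℝ}

theorem toTemperedDistribution_stepLp {ι : Type*} [Fintype ι] {A : ι → Set E}
    (hA : ∀ i, MeasurableSet (A i)) (hfin : ∀ i, volume (A i) ≠ ⊤) (p q : ℝ≥0∞) [Fact (1 ≤ p)]
    [Fact (1 ≤ q)] (a : ι → ℂ) :
    Lp.toTemperedDistribution (stepLp hA hfin p a)
      = Lp.toTemperedDistribution (stepLp hA hfin q a) :=
  toTemperedDistribution_congr_ae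
    ((coeFn_stepLp hA hfin p a).trans (coeFn_stepLp hA hfin q a).symm)

/-- On the step functions over fixed sets, an operator bounded on `L²` is a linear map from a finite
dimensional space.  This is the form in which interpolation is applied. -/
theorem exists_linearMap_stepLp (h1 : ∀ f : Lp ℂ 2 (volume : Measure E), MapsLpBound T 2 M₁ f)
    {ι : Type*} [Fintype ι] {A : ι → Set E} (hA : ∀ i, MeasurableSet (A i))
    (hfin : ∀ i, volume (A i) ≠ ⊤) :
    ∃ V : (ι → ℂ) →ₗ[ℂ] Lp ℂ 2 (volume : Measure E), ∀ a,
      T (Lp.toTemperedDistribution (stepLp hA hfin 2 a)) = Lp.toTemperedDistribution (V a) ∧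
        ‖V a‖ ≤ M₁ * ‖stepLp hA hfin 2 a‖ := by
  choose V hV hVn using fun a => h1 (stepLp hA hfin 2 a)
  refine ⟨{ toFun := V, map_add' := fun a b => ?_, map_smul' := fun c a => ?_ },
    fun a => ⟨hV a, hVn a⟩⟩
  · apply toTemperedDistribution_injective
    have e : ∀ f g : Lp ℂ 2 (volume : Measure E), Lp.toTemperedDistribution (f + g)
        = Lp.toTemperedDistribution f + Lp.toTemperedDistribution g := fun f g =>
      map_add (Lp.toTemperedDistributionCLM ℂ (volume : Measure E) 2) f g
    rw [← hV, map_add, e, map_add, hV, hV, e]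
  · apply toTemperedDistribution_injective
    have e : ∀ f : Lp ℂ 2 (volume : Measure E), Lp.toTemperedDistribution (c • f)
        = c • Lp.toTemperedDistribution f := fun f =>
      map_smul (Lp.toTemperedDistributionCLM ℂ (volume : Measure E) 2) c f
    rw [RingHom.id_apply, ← hV, map_smul, e, map_smul, hV, e]

theorem memLp_of_memLp_two_of_bounded {X : Type*} [MeasurableSpace X] {μ : Measure X} {u : X → ℂ}
    (hu : MemLp u 2 μ) {C : ℝ} (hC : ∀ᵐ x ∂μ, ‖u x‖ ≤ C) {r : ℝ≥0∞} (hr : 2 ≤ r) (hr' : r ≠ ⊤) :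
    MemLp u r μ := by
  have hR : 2 ≤ r.toReal := by
    have := ENNReal.toReal_mono hr' hr
    simpa using this
  have hr0 : r ≠ 0 := (lt_of_lt_of_le two_pos hr).ne'
  have h2 := hu.integrable_norm_rpow two_ne_zero ENNReal.ofNat_ne_top
  rw [← integrable_norm_rpow_iff hu.1 hr0 hr']
  refine (h2.const_mul (C ^ (r.toReal - 2))).mono'
    (hu.1.norm.aemeasurable.pow_const _).aestronglyMeasurable ?_
  filter_upwards [hC] with x hx
  rw [Real.norm_of_nonneg (by positivity)]
  have e : ‖u x‖ ^ r.toReal = ‖u x‖ ^ (r.toReal - 2) * ‖u x‖ ^ (2 : ℝ) := by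
    rw [← Real.rpow_add_of_nonneg (norm_nonneg _) (by linarith) (by norm_num)]
    congr 1; ring
  rw [e, ENNReal.toReal_ofNat]
  have h3 : 0 ≤ r.toReal - 2 := by linarith
  gcongr

/-- Interpolation between `L¹ → L^∞` and `L² → L²`, for an operator given on tempered
distributions. -/
theorem mapsLpBound_of_endpoints (hM₀ : 0 ≤ M₀) (hM₁ : 0 ≤ M₁)
    (h0 : ∀ f : Lp ℂ 1 (volume : Measure E), MapsLpBound T ⊤ M₀ f)
    (h1 : ∀ f : Lp ℂ 2 (volume : Measure E), MapsLpBound T 2 M₁ f) {r r' : ℝ≥0∞} [Fact (1 ≤ r)]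
    [hr'1 : Fact (1 ≤ r')] [hrr : ENNReal.HolderConjugate r r'] (hr2 : 2 ≤ r) (hr : r ≠ ⊤)
    (hr' : r' ≠ ⊤) (f : Lp ℂ r' (volume : Measure E)) :
    MapsLpBound T r (M₀ ^ (1 - 2 * r⁻¹.toReal) * M₁ ^ (2 * r⁻¹.toReal)) f := by
  have hconj : r.toReal.HolderConjugate r'.toReal :=
    ENNReal.HolderConjugate.toReal_of_ne_top hr hr'
  have hR : 2 ≤ r.toReal := by
    have := ENNReal.toReal_mono hr hr2
    simpa using this
  have hr'0 : r' ≠ 0 := (lt_of_lt_of_le one_pos hr'1.out).ne'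
  have hθ : r⁻¹.toReal = r.toReal⁻¹ := ENNReal.toReal_inv r
  have hθ0 : 0 ≤ 2 * r⁻¹.toReal := by positivity
  have hθ1 : 2 * r⁻¹.toReal ≤ 1 := by
    rw [hθ, ← div_eq_mul_inv, div_le_one (by linarith)]
    exact hR
  have hp : r'.toReal * (1 - 2 * r⁻¹.toReal / 2) = 1 := by
    have h2 := hconj.symm.pos.ne'
    rw [mul_div_cancel_left₀ _ two_ne_zero, hθ, hconj.one_sub_inv, mul_inv_cancel₀ h2]
  have hsimple : ∀ g ∈ Lp.simpleFunc ℂ r' (volume : Measure E), ∃ (s : Finset ℂ) (A : s → Set E)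
      (hA : ∀ i, MeasurableSet (A i)) (hfin : ∀ i, volume (A i) ≠ ⊤) (a : s → ℂ),
      (Pairwise fun i j => Disjoint (A i) (A j)) ∧ g = stepLp hA hfin r' a := by
    intro g hg
    obtain ⟨s, A, a, hA, hfin, hdisj, he⟩ := exists_eq_stepFun
      (Lp.simpleFunc.toSimpleFunc ⟨g, hg⟩) hr'0 hr' (Lp.simpleFunc.memLp ⟨g, hg⟩)
    refine ⟨s, A, hA, hfin, a, hdisj, Lp.ext ?_⟩
    have := Lp.simpleFunc.toSimpleFunc_eq_toFun (⟨g, hg⟩ : Lp.simpleFunc ℂ r' (volume : Measure E))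
    rw [he] at this
    exact this.symm.trans (coeFn_stepLp hA hfin r' a).symm
  refine mapsLpBound_of_dense (D := Lp.simpleFunc ℂ r' (volume : Measure E))
    (Lp.simpleFunc.dense hr') (fun f hf => ?_) f
  obtain ⟨s, A, hA, hAfin, a, hAdisj, rfl⟩ := hsimple f hf
  obtain ⟨V, hV⟩ := exists_linearMap_stepLp h1 hA hAfin
  choose G hG hGn using fun a => h0 (stepLp hA hAfin 1 a)
  -- both endpoint images of a step function represent the same distribution
  have hGV : ∀ a, G a =ᵐ[volume] V a := fun a => by
    apply ae_eq_of_toTemperedDistribution_eq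
    rw [← hG, ← (hV a).1, toTemperedDistribution_stepLp hA hAfin 1 2]
  have hbdd : ∀ᵐ x, ‖V a x‖ ≤ ‖G a‖ := by
    have hb : ∀ᵐ x, ‖G a x‖ₑ ≤ eLpNormEssSup (G a) volume := ae_le_eLpNormEssSup
    filter_upwards [hGV a, hb] with x hx hx'
    rw [← hx, Lp.norm_def, eLpNorm_exponent_top, ← toReal_enorm]
    have hne := (Lp.memLp (G a)).2.ne
    rw [eLpNorm_exponent_top] at hne
    exact ENNReal.toReal_mono hne hx'
  have hu : MemLp (V a) r volume := memLp_of_memLp_two_of_bounded (Lp.memLp _) hbdd hr2 hr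
  refine ⟨hu.toLp, ?_, ?_⟩
  · rw [toTemperedDistribution_stepLp hA hAfin r' 2, (hV a).1]
    exact toTemperedDistribution_congr_ae hu.coeFn_toLp.symm
  · refine norm_le_of_forall_simpleFunc (r' := r') hr hr' hu.toLp (by positivity) fun g hg => ?_
    obtain ⟨t, B, hB, hBfin, b, hBdisj, rfl⟩ := hsimple g hg
    set Λ : (s → ℂ) →ₗ[ℂ] (t → ℂ) →ₗ[ℂ] ℂ :=
      LinearMap.compl₁₂ ((ContinuousLinearMap.coeLM ℂ).comp (lpPair volume 2 2).toLinearMap)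
        V (stepLp hB hBfin 2) with hΛ
    have hΛ' : ∀ a b, Λ a b = ∫ x, V a x * stepFun B b x := by
      intro a b
      have : Λ a b = lpPair volume 2 2 (V a) (stepLp hB hBfin 2 b) := rfl
      rw [this, lpPair_apply]
      exact integral_congr_ae ((coeFn_stepLp hB hBfin 2 b).mono fun x hx => by simp only [hx])
    have hpair : lpPair volume r r' hu.toLp (stepLp hB hBfin r' b) = Λ a b := by
      rw [hΛ', lpPair_apply]
      refine integral_congr_ae ?_
      filter_upwards [coeFn_stepLp hB hBfin r' b, hu.coeFn_toLp] with x hx hx'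
      rw [hx, hx']
    have e0 : ∀ a b, ‖Λ a b‖ ≤ M₀ * weightedNorm (fun i => volume.real (A i)) 1 a
        * weightedNorm (fun i => volume.real (B i)) 1 b := by
      intro a b
      have e : Λ a b = lpPair volume ⊤ 1 (G a) (stepLp hB hBfin 1 b) := by
        rw [hΛ', lpPair_apply]
        refine integral_congr_ae ?_
        filter_upwards [coeFn_stepLp hB hBfin 1 b, hGV a] with x hx hx'
        rw [hx, hx']
      have n1 := norm_stepLp hA hAfin hAdisj one_ne_zero ENNReal.one_ne_top a
      have n2 := norm_stepLp hB hBfin hBdisj one_ne_zero ENNReal.one_ne_top b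
      rw [ENNReal.toReal_one] at n1 n2
      rw [e, ← n1, ← n2]
      exact (norm_lpPair_le _ _).trans (mul_le_mul_of_nonneg_right (hGn a) (norm_nonneg _))
    have e1 : ∀ a b, ‖Λ a b‖ ≤ M₁ * weightedNorm (fun i => volume.real (A i)) 2 a
        * weightedNorm (fun i => volume.real (B i)) 2 b := by
      intro a b
      have n1 := norm_stepLp hA hAfin hAdisj two_ne_zero ENNReal.ofNat_ne_top a
      have n2 := norm_stepLp hB hBfin hBdisj two_ne_zero ENNReal.ofNat_ne_top b
      rw [ENNReal.toReal_ofNat] at n1 n2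
      rw [← n1, ← n2]
      exact (norm_lpPair_le _ _).trans (mul_le_mul_of_nonneg_right (hV a).2 (norm_nonneg _))
    rw [hpair, norm_stepLp hA hAfin hAdisj hr'0 hr', norm_stepLp hB hBfin hBdisj hr'0 hr']
    exact norm_le_weightedNorm_of_endpoints (fun _ => measureReal_nonneg)
      (fun _ => measureReal_nonneg) Λ hM₀ hM₁ e0 e1 hθ0 hθ1 hp a b

end Interpolation

/-! ### The dispersive estimate -/

theorem mainTheorem4 (χ : ℝ → ℝ) (hχ : IsCutoff χ) (d : ℕ) (hd : d = 1 ∨ d = 2) :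
    ∃ C : ℝ, 0 < C ∧
      (∀ (k : ℤ) (lam : ℝ), lam = (2 : ℝ) ^ k → 1 < lam →
        ∀ t : ℝ, t ≠ 0 → ∀ τ : ℝ, (τ = t ∨ τ = -t) →
        ∀ f : Lp ℂ 1 (volume : Measure (EuclideanSpace ℝ (Fin d))),
        ∃ g : Lp ℂ ∞ (volume : Measure (EuclideanSpace ℝ (Fin d))),
          localizedWave χ d lam τ (Lp.toTemperedDistribution f) = Lp.toTemperedDistribution g ∧
          ‖g‖ ≤ C * (lam ^ (3 * (d : ℝ) / 4) * |t| ^ (-(d : ℝ) / 2)) * ‖f‖) ∧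
      (∀ (k : ℤ) (lam : ℝ), lam = (2 : ℝ) ^ k → 1 < lam →
        ∀ t : ℝ, t ≠ 0 → ∀ τ : ℝ, (τ = t ∨ τ = -t) →
        ∀ (r r' : ℝ≥0∞) [Fact (1 ≤ r)] [Fact (1 ≤ r')], 2 ≤ r → r.HolderConjugate r' →
        ∀ f : Lp ℂ r' (volume : Measure (EuclideanSpace ℝ (Fin d))),
        ∃ g : Lp ℂ r (volume : Measure (EuclideanSpace ℝ (Fin d))),
          localizedWave χ d lam τ (Lp.toTemperedDistribution f) = Lp.toTemperedDistribution g ∧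
          ‖g‖ ≤ C * (lam ^ (3 * (d : ℝ) / 4) * |t| ^ (-(d : ℝ) / 2)) ^ (1 - 2 * r⁻¹.toReal)
            * ‖f‖) := by
  obtain ⟨C, hC, h⟩ := exists_mapsLpBound_localizedWave hχ hd
  have hlam2 : ∀ (k : ℤ) (lam : ℝ), lam = (2 : ℝ) ^ k → 1 < lam → 2 ≤ lam := by
    rintro k lam rfl hk
    have hk1 : (0 : ℤ) < k := by
      rw [← zpow_zero (2 : ℝ)] at hk
      exact (zpow_lt_zpow_iff_right₀ one_lt_two).1 hk
    calc (2 : ℝ) = 2 ^ (1 : ℤ) := by norm_num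
      _ ≤ 2 ^ k := zpow_le_zpow_right₀ one_le_two hk1
  have habs : ∀ t τ : ℝ, (τ = t ∨ τ = -t) → |t| = |τ| := by
    rintro t τ (rfl | rfl) <;> simp
  have hends : ∀ (k : ℤ) (lam : ℝ), lam = (2 : ℝ) ^ k → 1 < lam →
      ∀ t : ℝ, t ≠ 0 → ∀ τ : ℝ, (τ = t ∨ τ = -t) →
      (∀ f : Lp ℂ 1 (volume : Measure (EuclideanSpace ℝ (Fin d))), MapsLpBound
        (localizedWave χ d lam τ) ⊤ (C * (lam ^ (3 * (d : ℝ) / 4) * |t| ^ (-(d : ℝ) / 2))) f) ∧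
      ∀ f : Lp ℂ 2 (volume : Measure (EuclideanSpace ℝ (Fin d))),
        MapsLpBound (localizedWave χ d lam τ) 2 C f := by
    intro k lam hk hl t ht τ hτ
    have hτ0 : τ ≠ 0 := by rwa [← abs_pos, ← habs t τ hτ, abs_pos]
    rw [habs t τ hτ, ← dispersiveRate_pow (by linarith : 0 < lam) τ d]
    exact h lam τ (hlam2 k lam hk hl) hτ0
  refine ⟨C, hC, fun k lam hk hl t ht τ hτ f => (hends k lam hk hl t ht τ hτ).1 f,
    fun k lam hk hl t ht τ hτ r r' hr1 hr1' hr2 hrr f => ?_⟩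
  obtain ⟨h1, h2⟩ := hends k lam hk hl t ht τ hτ
  have hP : 0 ≤ lam ^ (3 * (d : ℝ) / 4) * |t| ^ (-(d : ℝ) / 2) := by positivity
  set P := lam ^ (3 * (d : ℝ) / 4) * |t| ^ (-(d : ℝ) / 2) with hPdef
  have hinv : r⁻¹ + r'⁻¹ = 1 := ENNReal.holderConjugate_iff.1 hrr
  rcases eq_or_ne r ⊤ with rfl | hr
  · obtain rfl : r' = 1 := by simpa using hinv
    obtain ⟨g, hg, hgn⟩ := h1 f
    exact ⟨g, hg, by simpa using hgn⟩
  · have hr' : r' ≠ ⊤ := by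
      rintro rfl
      have : r = 1 := by simpa using hinv
      rw [this] at hr2
      norm_num at hr2
    obtain ⟨g, hg, hgn⟩ := mapsLpBound_of_endpoints (by positivity) hC.le h1 h2 hr2 hr hr' f
    refine ⟨g, hg, hgn.trans (le_of_eq ?_)⟩
    -- the constants of the two endpoints are both `C`, and `C^{1-θ} C^θ = C`
    rw [Real.mul_rpow hC.le hP, mul_right_comm (C ^ _), ← Real.rpow_add hC, sub_add_cancel,
      Real.rpow_one]
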